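/- Let $H\in(1/2,1)$, $a,b\in\mathbb R$, $ab\neq0$. Put $c(H)=\sqrt{\frac{2H\,\Gamma(3/2-H)}{\Gamma(H+1/2)\,\Gamma(2-2H)}}\,(H-\tfrac12)$, $$K_H(t,s)=c(H)\,s^{\frac12-H}\int_s^t \frac{v^{H-\frac12}}{(v-s)^{\frac32-H}}\,dv\quad(0<s<t),\qquad K_H(t,s)=0\quad(s\ge t),$$ $\mathbf 1_t=\mathbf 1_{[0,t)}$ and $L(t,s)=a\mathbf 1_t(s)+bK_H(t,s)$. Let $X=aW+bB^H$ be the completely correlated mixed fractional Brownian motion, where $W=(W_t)_{t\ge0}$ is a Brownian motion and $B^H_t=\int_0^tK_H(t,s)\,dW_s$, and let $$R(t,s)=a^2(t\wedge s)+ab\int_0^{t\wedge s}[K_H(t,v)+K_H(s,v)]\,dv+\tfrac{b^2}{2}\left[t^{2H}+s^{2H}-|t-s|^{2H}\right]$$ be its covariance function. Fix $u\ge0$ and let $\mathcal F^X_u=\sigma(X_s:s\le u)$. For $f\in L^2([0,u])$ the Wiener integral $\int_0^uf(s)\,dX_s$ is the $L^2(\mathbb P)$-limit of $\sum_ic_iX_{t_i}$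 along step functions $\sum_ic_i\mathbf 1_{t_i}$, $t_i\in[0,u]$, that converge to $f$ in $L^2([0,u])$. Theorem. (i) There is exactly one bounded linear operator $\mathrm L^*$ on $L^2([0,u])$ with $\mathrm L^*\mathbf 1_t=L(t,\cdot)$ for all $t\in[0,u]$, and it has a bounded inverse. For $t\ge u$ let $\Psi(t,\cdot|u)=(\mathrm L^*)^{-1}[L(t,\cdot)-L(u,\cdot)]\in L^2([0,u])$. (ii) For every $t\ge u$ the Wiener integral $\int_0^u\Psi(t,s|u)\,dX_s$ exists, and almost surely $$\hat m_t(u):=\mathbb E[X_t|\mathcal F^X_u]=X_u+\int_0^u\Psi(t,s|u)\,dX_s .$$ (iii) For all $s,t\ge u$, almost surely $$\operatorname{Cov}[X_t,X_s|\mathcal F^X_u]=\hat R(t,s|u):=R(t,s)-\int_0^uL(t,v)L(s,v)\,dv,$$ which is deterministic. (iv) Given $\mathcal F^X_u$, the future process $(X_t)_{t\ge u}$ is Gaussian with mean $\hat m_t(u)$ and covariance $\hat R(t,s|u)$: it has a regular conditional law $\kappa_\omega$ on $\mathbb R^{[u,\infty)}$ given $\mathcal F^X_u$ such that for every $\omega$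 the coordinate process is Gaussian under $\kappa_\omega$ with covariance function $\hat R(\cdot,\cdot|u)$, and for every $t\ge u$ its mean at $t$ equals $\hat m_t(u)(\omega)$ for almost every $\omega$. -/

import Mathlib

open MeasureTheory ProbabilityTheory Filter Topology
open scoped NNReal ENNReal

noncomputable section

namespace CcmfBm

/-- The constant `c(H)` of the Molchan–Golosov kernel. -/
def c (H : ℝ) : ℝ :=
  Real.sqrt (2 * H * Real.Gamma (3 / 2 - H) / (Real.Gamma (H + 1 / 2) * Real.Gamma (2 - 2 * H))) *
    (H - 1 / 2)

/-- The Molchan–Golosov kernel `K_H(t,s)`, a Volterra kernel on `0 < s < t`. (Its value at the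
single point `s = 0`, where the formula has no meaning, is irrelevant.) -/
def KH (H t s : ℝ) : ℝ :=
  if s < t then
    c H * (1 / s ^ (H - 1 / 2)) * ∫ v in s..t, v ^ (H - 1 / 2) / (v - s) ^ (3 / 2 - H)
  else 0

/-- The indicator function `1_t = 1_{[0,t)}`. -/
def ind (t s : ℝ) : ℝ := (Set.Ico 0 t).indicator 1 s

/-- The kernel `L(t,s) = a 1_t(s) + b K_H(t,s)`. -/
def L (H a b t s : ℝ) : ℝ := a * ind t s + b * KH H t s

/-- The covariance function `R_H` of fractional Brownian motion. -/
def RH (H t s : ℝ) : ℝ := 1 / 2 * (t ^ (2 * H) + s ^ (2 * H) - |t - s| ^ (2 * H))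

/-- The covariance function `R` of the completely correlated mixed fractional Brownian motion. -/
def R (H a b t s : ℝ) : ℝ :=
  a ^ 2 * min t s + a * b * (∫ v in (0 : ℝ)..(min t s), (KH H t v + KH H s v)) + b ^ 2 * RH H t s

/-- A linear combination `φ` of times `t` stands for the step function `∑ φ(t) 1_t`. -/
def stepFun (φ : ℝ≥0 →₀ ℝ) (s : ℝ) : ℝ := φ.sum fun t r => r * ind t s

/-- The elementary integral `∑ φ(t) Z_t` of the step function `∑ φ(t) 1_t` against `Z`. -/
def stepIntegral {Ω : Type*} (Z : ℝ≥0 → Ω → ℝ) (φ : ℝ≥0 →₀ ℝ) (ω : Ω) : ℝ :=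
  φ.sum fun t r => r * Z t ω

/-- Lebesgue measure on `[0,u]`. -/
abbrev lebesgueOn (u : ℝ≥0) : Measure ℝ := volume.restrict (Set.Icc (0 : ℝ) u)

/-- The Hilbert space `L²([0,u])`. -/
abbrev L2 (u : ℝ≥0) : Type := Lp ℝ 2 (lebesgueOn u)

/-- `Y` is (a version of) the Wiener integral `∫_0^u f(s) dZ_s`: there are step functions
`φ_n = ∑ φ_n(t) 1_t` with jump times `t ≤ u` that converge to `f` in `L²([0,u])` and whose
elementary integrals `∑ φ_n(t) Z_t` converge to `Y` in `L²(P)`. Since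
`‖∑ φ(t) 1_t‖_Λ = ‖∑ φ(t) Z_t‖_{L²(P)}` for the norm generated by the covariance of `Z`, the
second convergence makes `φ_n` Cauchy in the integrand space `Λ`, and the first identifies its
limit there with the function `f`. -/
def IsWienerIntegral {Ω : Type*} [MeasurableSpace Ω] (Z : ℝ≥0 → Ω → ℝ) (P : Measure Ω)
    (u : ℝ≥0) (f : ℝ → ℝ) (Y : Ω → ℝ) : Prop :=
  MemLp f 2 (lebesgueOn u) ∧ MemLp Y 2 P ∧
    ∃ φ : ℕ → (ℝ≥0 →₀ ℝ), (∀ n, ∀ t ∈ (φ n).support, t ≤ u) ∧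
      Tendsto (fun n => eLpNorm (fun s => f s - stepFun (φ n) s) 2 (lebesgueOn u)) atTop (𝓝 0) ∧
      Tendsto (fun n => eLpNorm (fun ω => Y ω - stepIntegral Z (φ n) ω) 2 P) atTop (𝓝 0)

/-- `X` is a completely correlated mixed fractional Brownian motion: `X = a W + b B^H`, where `W`
is a Brownian motion and `B^H_t = ∫_0^t K_H(t,s) dW_s`. Brownian motion is here the centered
Gaussian process with covariance `min t s`; continuity of the paths is not required. -/
def IsCcmfBm {Ω : Type*} [MeasurableSpace Ω] (H a b : ℝ) (X : ℝ≥0 → Ω → ℝ) (P : Measure Ω) :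
    Prop :=
  ∃ W BH : ℝ≥0 → Ω → ℝ, IsPreBrownianReal W P ∧
    (∀ t, IsWienerIntegral W P t (KH H t) (BH t)) ∧
    ∀ t, X t =ᵐ[P] fun ω => a * W t ω + b * BH t ω

/-- The σ-algebra `F_u^X = σ(X_s : s ≤ u)`. -/
@[reducible]
def sigmaUpTo {Ω : Type*} (X : ℝ≥0 → Ω → ℝ) (u : ℝ≥0) : MeasurableSpace Ω :=
  ⨆ s ≤ u, MeasurableSpace.comap (X s) inferInstance

/-- The bounded operator `A` on `L²([0,u])` is the adjoint associated operator `K^*` of the kernel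
`K` on the interval `[0,u]`: it is the extension of `1_t ↦ K(t,·)`, `t ∈ [0,u]`. As the linear span
of the `1_t` is dense, there is at most one such `A`. -/
def IsAdjointAssociated (K : ℝ → ℝ → ℝ) (u : ℝ≥0) (A : L2 u →L[ℝ] L2 u) : Prop :=
  ∀ t : ℝ, 0 ≤ t → t ≤ u → ∀ f : L2 u, f =ᵐ[lebesgueOn u] ind t → A f =ᵐ[lebesgueOn u] K t

/-- The conditional covariance `R(t,s) - ∫_0^u L(t,v) L(s,v) dv`. -/
def condR (H a b : ℝ) (u t s : ℝ) : ℝ :=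
  R H a b t s - ∫ v in (0 : ℝ)..u, L H a b t v * L H a b s v

/-- `κ` is a regular conditional law of `Y` given the σ-algebra `m`. -/
def IsRegularCondLaw {Ω E : Type*} (m : MeasurableSpace Ω) [mΩ : MeasurableSpace Ω]
    [MeasurableSpace E] (Y : Ω → E) (κ : @Kernel Ω E m _) (P : @Measure Ω mΩ) : Prop :=
  ∀ B : Set E, MeasurableSet B → (fun ω => (κ ω).real B) =ᵐ[P] P⟦Y ⁻¹' B | m⟧

end CcmfBm

end

/-! The Wiener isometry `I` of `W` maps L²(ℝ₊) into L²(P) and gives X_t = I(L(t,·))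
(`exists_isometry_of_isCcmfBm`), which turns prediction into Hilbert space geometry. For t ≥ u,
almost everywhere on ℝ₊, L(t,·) = L(u,·) + 1_{[0,u]} [L(t,·) - L(u,·)] + 1_{[u,∞)} L(t,·). The last
term is orthogonal to every L(s,·) with s ≤ u, because these Volterra kernels vanish beyond s; by
joint Gaussianity its image is independent of F_u. The middle term is L^* Ψ, extended by zero. The
bounded operator J = I ∘ (extension by zero) ∘ L^* sends 1_t to X_t for t ≤ u, so it is the Wiener
integral against X, and the image of the middle term is ∫ Ψ dX. As an L²-limit of step integrals
this is measurable with respect to F_u up to null sets. Hence the conditional mean is the image of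
the first two terms, the conditional covariance is the Gram matrix of the functions 1_{[u,∞)}
L(t,·), and the conditional law is a fixed centered Gaussian law translated by the conditional mean.

Two analytic facts support this. First, L^* is bounded and invertible. With α = H - 1/2 and k =
`mgKernel α` one has K_H(t,s) = c(H) ∫_0^t k(s,v) dv, so L^* = a + b c(H) T, where T has kernel k.
Conjugation by e^{rs} multiplies k by e^{-r(v-s)}; Schur's test with weight s^{-α} bounds the damped
operator by a constant times r^{-α/2}, and for large r a Neumann series inverts L^*
(`exists_equiv_add_mgKernel`). Second, ∫ K_H(t,·) K_H(r,·) is the covariance of fractional Brownian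
motion (`integral_KH_mul_KH`); Tonelli's theorem reduces this to a Beta integral for k
(`lintegral_mgKernel_mul_mgKernel`). It puts the kernels in L² and identifies the conditional
covariance. -/

namespace CcmfBm

/-! ### Isometries from equal Gram matrices -/

section Hilbert

variable {ι E F : Type*} [NormedAddCommGroup E] [InnerProductSpace ℝ E]
  [NormedAddCommGroup F] [InnerProductSpace ℝ F]

theorem inner_linearCombination (v : ι → E) (φ ψ : ι →₀ ℝ) :
    inner ℝ (Finsupp.linearCombination ℝ v φ) (Finsupp.linearCombination ℝ v ψ) =
      φ.sum fun i r => ψ.sum fun j q => r * (q * inner ℝ (v i) (v j)) := by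
  simp only [Finsupp.linearCombination_apply, Finsupp.sum, sum_inner, inner_sum,
    inner_smul_left, inner_smul_right, conj_trivial, Finset.mul_sum]
  rw [Finset.sum_comm]
  exact Finset.sum_congr rfl fun i _ => Finset.sum_congr rfl fun j _ => by ring

theorem denseRange_linearCombination {v : ι → E}
    (hv : (Submodule.span ℝ (Set.range v)).topologicalClosure = ⊤) :
    DenseRange (Finsupp.linearCombination ℝ v) := by
  rw [DenseRange, ← LinearMap.coe_range, Finsupp.range_linearCombination]
  exact (Submodule.dense_iff_topologicalClosure_eq_top).2 hv

/-- A family with the same Gram matrix as a total family is its image under an isometry. -/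
theorem exists_linearIsometry_of_inner_eq [CompleteSpace F] {v : ι → E} {w : ι → F}
    (hv : (Submodule.span ℝ (Set.range v)).topologicalClosure = ⊤)
    (h : ∀ i j, inner ℝ (w i) (w j) = inner ℝ (v i) (v j)) :
    ∃ I : E →ₗᵢ[ℝ] F, ∀ i, I (v i) = w i := by
  have hd := denseRange_linearCombination hv
  have hn (φ : ι →₀ ℝ) : ‖Finsupp.linearCombination ℝ w φ‖ = ‖Finsupp.linearCombination ℝ v φ‖ := by
    rw [@norm_eq_sqrt_real_inner E, @norm_eq_sqrt_real_inner F, inner_linearCombination,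
      inner_linearCombination]
    simp only [h]
  -- Equality of norms makes the map from combinations of `v` to combinations of `w` well defined
  -- and bounded by 1, so it extends from a dense subspace.
  have he (φ : ι →₀ ℝ) := LinearMap.extendOfNorm_eq hd ⟨1, fun x => by rw [one_mul, hn]⟩ φ
  refine ⟨⟨((Finsupp.linearCombination ℝ w).extendOfNorm
    (Finsupp.linearCombination ℝ v)).toLinearMap, fun x => ?_⟩, fun i => ?_⟩
  · refine hd.induction ?_ (isClosed_eq (by fun_prop) (by fun_prop)) x
    rintro _ ⟨φ, rfl⟩
    simpa [he] using hn φ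
  · simpa using he (Finsupp.single i 1)

end Hilbert

/-! ### Linear combinations and inner products in L² -/

section Lp

variable {α ι : Type*} {mα : MeasurableSpace α} {μ : Measure α}

theorem coeFn_linearCombination_toLp {F : ι → α → ℝ} (hF : ∀ i, MemLp (F i) 2 μ) (φ : ι →₀ ℝ) :
    Finsupp.linearCombination ℝ (fun i => (hF i).toLp (F i)) φ =ᵐ[μ]
      fun x => φ.sum fun i r => r * F i x := by
  rw [Finsupp.linearCombination_apply, Finsupp.sum]
  refine (Lp.coeFn_finsetSum _ _).trans ?_
  have : ∀ᵐ x ∂μ, ∀ i : φ.support, (φ i • (hF i).toLp (F i) : Lp ℝ 2 μ) x = φ i * F i x := by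
    refine ae_all_iff.2 fun i => ?_
    filter_upwards [Lp.coeFn_smul (φ i) ((hF i).toLp (F i)), (hF i).coeFn_toLp] with x h1 h2
    rw [h1, Pi.smul_apply, h2, smul_eq_mul]
  filter_upwards [this] with x hx
  rw [Finset.sum_apply, Finsupp.sum]
  exact Finset.sum_congr rfl fun i hi => hx ⟨i, hi⟩

theorem inner_toLp {f g : α → ℝ} (hf : MemLp f 2 μ) (hg : MemLp g 2 μ) :
    inner ℝ (hf.toLp f) (hg.toLp g) = ∫ x, f x * g x ∂μ := by
  rw [L2.inner_def]
  refine integral_congr_ae ?_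
  filter_upwards [hf.coeFn_toLp, hg.coeFn_toLp] with x h1 h2
  simp [h1, h2, mul_comm]

end Lp

/-! ### Gaussian laws under L² limits -/

section Gaussian

variable {Ω : Type*} [MeasurableSpace Ω] {P : Measure Ω} [IsProbabilityMeasure P]

theorem integral_norm_le_norm_Lp (Y : Lp ℝ 2 P) : ∫ ω, ‖Y ω‖ ∂P ≤ ‖Y‖ := by
  rw [integral_norm_eq_lintegral_enorm (Lp.aestronglyMeasurable Y), ← eLpNorm_one_eq_lintegral_enorm,
    Lp.norm_def]
  exact ENNReal.toReal_mono (Lp.eLpNorm_ne_top Y)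
    (eLpNorm_le_eLpNorm_of_exponent_le (by norm_num) (Lp.aestronglyMeasurable Y))

theorem norm_exp_I_mul_sub_le (x y : ℝ) :
    ‖Complex.exp (x * Complex.I) - Complex.exp (y * Complex.I)‖ ≤ ‖x - y‖ := by
  have : Complex.exp (x * Complex.I) - Complex.exp (y * Complex.I) =
      Complex.exp (y * Complex.I) * (Complex.exp (Complex.I * (x - y : ℝ)) - 1) := by
    rw [mul_sub, ← Complex.exp_add, mul_one]
    push_cast
    ring_nf
  rw [this, norm_mul, Complex.norm_exp_ofReal_mul_I, one_mul]
  exact Real.norm_exp_I_mul_ofReal_sub_one_le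

theorem integrable_exp_I_mul (x : ℝ) {Y : Ω → ℝ} (hY : AEStronglyMeasurable Y P) :
    Integrable (fun ω => Complex.exp ((x * Y ω : ℝ) * Complex.I)) P := by
  refine (integrable_const (1 : ℝ)).mono' ?_ (Eventually.of_forall fun ω => ?_)
  · exact (by fun_prop : Continuous fun y : ℝ =>
      Complex.exp ((x * y : ℝ) * Complex.I)).comp_aestronglyMeasurable hY
  · rw [Complex.norm_exp_ofReal_mul_I]

/-- The map y ↦ e^{iy} is 1-Lipschitz and the L¹ norm is at most the L² norm on a probability space,
so the characteristic function at `x` is |x|-Lipschitz on L². This lets Gaussian laws pass to L²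
limits. -/
theorem continuous_integral_exp (x : ℝ) :
    Continuous fun Y : Lp ℝ 2 P => ∫ ω, Complex.exp ((x * Y ω : ℝ) * Complex.I) ∂P := by
  refine (LipschitzWith.of_dist_le_mul (K := ‖x‖₊) fun Y Z => ?_).continuous
  have hY := integrable_exp_I_mul x (Lp.aestronglyMeasurable Y)
  have hZ := integrable_exp_I_mul x (Lp.aestronglyMeasurable Z)
  rw [dist_eq_norm, dist_eq_norm, ← integral_sub hY hZ, coe_nnnorm]
  calc _ ≤ ∫ ω, ‖x‖ * ‖(Y - Z) ω‖ ∂P := by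
        refine norm_integral_le_of_norm_le ?_ ?_
        · exact ((Lp.memLp (Y - Z)).integrable (by norm_num)).norm.const_mul _
        · filter_upwards [Lp.coeFn_sub Y Z] with ω h
          refine (norm_exp_I_mul_sub_le _ _).trans ?_
          rw [h, ← mul_sub, norm_mul, Pi.sub_apply]
    _ ≤ ‖x‖ * ‖Y - Z‖ := by
        rw [integral_const_mul]
        exact mul_le_mul_of_nonneg_left (integral_norm_le_norm_Lp _) (norm_nonneg _)

variable {ι E : Type*} [NormedAddCommGroup E] [InnerProductSpace ℝ E]

theorem hasLaw_gaussianReal_of_integral_exp {Y : Ω → ℝ} (hY : AEStronglyMeasurable Y P) {v : ℝ≥0}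
    (h : ∀ x : ℝ, ∫ ω, Complex.exp ((x * Y ω : ℝ) * Complex.I) ∂P =
      Complex.exp (-(v * x ^ 2 / 2 : ℝ))) : HasLaw Y (gaussianReal 0 v) P := by
  have := Measure.isProbabilityMeasure_map (μ := P) hY.aemeasurable
  refine ⟨hY.aemeasurable, Measure.ext_of_charFun (funext fun x => ?_)⟩
  rw [charFun_gaussianReal, charFun_apply_real, integral_map hY.aemeasurable
    (by fun_prop)]
  convert h x using 2
  · norm_cast
  · push_cast; ring_nf

/-- The extension by isometry of a centered Gaussian process is a centered Gaussian process. -/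
theorem hasLaw_linearIsometry {W : ι → Ω → ℝ} (hW : IsGaussianProcess W P)
    (hW0 : ∀ i, P[W i] = 0) {v : ι → E}
    (hv : (Submodule.span ℝ (Set.range v)).topologicalClosure = ⊤)
    (I : E →ₗᵢ[ℝ] Lp ℝ 2 P) (hI : ∀ i, I (v i) =ᵐ[P] W i) (f : E) :
    HasLaw (I f) (gaussianReal 0 (‖f‖₊ ^ 2)) P := by
  refine hasLaw_gaussianReal_of_integral_exp (Lp.aestronglyMeasurable _) fun x => ?_
  -- Both sides are continuous in `f`, so finite combinations suffice; there `I f` is a finite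
  -- combination of the `W i`, hence centered Gaussian with variance ‖f‖².
  refine (denseRange_linearCombination hv).induction (P := fun f =>
    ∫ ω, Complex.exp ((x * I f ω : ℝ) * Complex.I) ∂P =
      Complex.exp (-((‖f‖₊ ^ 2 : ℝ≥0) * x ^ 2 / 2 : ℝ))) ?_ (isClosed_eq
    ((continuous_integral_exp x).comp I.continuous) (by fun_prop)) f
  rintro _ ⟨φ, rfl⟩
  have hm (i : ι) : MemLp (W i) 2 P := (hW.hasGaussianLaw_eval i).memLp_two
  have hIv : (fun i => I (v i)) = fun i => (hm i).toLp (W i) := by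
    ext1 i
    exact Lp.ext ((hI i).trans (hm i).coeFn_toLp.symm)
  have hI' : I (Finsupp.linearCombination ℝ v φ) =
      Finsupp.linearCombination ℝ (fun i => (hm i).toLp (W i)) φ := by
    rw [← hIv]
    simp [Finsupp.linearCombination_apply, Finsupp.sum]
  have hY := coeFn_linearCombination_toLp hm φ
  rw [← hI'] at hY
  set Y := I (Finsupp.linearCombination ℝ v φ) with hYdef
  have hG : HasGaussianLaw Y P := by
    refine HasGaussianLaw.congr ?_ hY.symm
    exact (hW.smul φ).hasGaussianLaw_fun_sum (I := φ.support)
  have hY0 : P[Y] = 0 := by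
    rw [integral_congr_ae hY]
    simp only [Finsupp.sum]
    rw [integral_finsetSum _ fun i _ => ((hm i).integrable (by norm_num)).const_mul _]
    simp [integral_const_mul, hW0]
  have hV : Var[Y; P] = ‖Finsupp.linearCombination ℝ v φ‖ ^ 2 := by
    rw [variance_of_integral_eq_zero hG.aemeasurable hY0, ← I.norm_map, ← hYdef,
      ← real_inner_self_eq_norm_sq, L2.inner_def]
    simp [sq]
  have h := hG.charFun_map_eq x
  rw [charFun_apply_real, integral_map hG.aemeasurable (by fun_prop)] at h
  have h1 : P[fun ω => inner ℝ x (Y ω)] = 0 := by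
    simp [integral_mul_const, hY0]
  have h2 : Var[fun ω => inner ℝ x (Y ω); P] = x ^ 2 * ‖Finsupp.linearCombination ℝ v φ‖ ^ 2 := by
    rw [← hV, ← variance_const_mul]
    simp [mul_comm]
  rw [h1, h2] at h
  convert h using 2
  · norm_cast
  · push_cast [coe_nnnorm]; ring_nf

end Gaussian

/-- A linear functional of finitely many `I f` is again `I` of a vector, so one-dimensional
Gaussianity already gives joint Gaussianity. -/
theorem isGaussianProcess_linearIsometry {Ω E : Type*} [MeasurableSpace Ω] {P : Measure Ω}
    [NormedAddCommGroup E] [InnerProductSpace ℝ E] (I : E →ₗᵢ[ℝ] Lp ℝ 2 P)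
    (h : ∀ f, HasGaussianLaw (I f) P) : IsGaussianProcess (fun f => ⇑(I f)) P := by
  classical
  refine ⟨fun J => ⟨isGaussian_of_map_eq_gaussianReal fun L => ?_⟩⟩
  have hm : AEMeasurable (fun ω => J.restrict fun f => I f ω) P :=
    aemeasurable_pi_lambda _ fun f => (h f).aemeasurable
  rw [AEMeasurable.map_map_of_aemeasurable (by fun_prop) hm]
  refine ⟨_, _, (HasGaussianLaw.congr (h (∑ f : J, L (Pi.single f 1) • (f : E))) ?_).map_eq_gaussianReal⟩
  rw [map_sum]
  refine (Lp.coeFn_finsetSum _ _).trans ?_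
  have : ∀ᵐ ω ∂P, ∀ f : J, I (L (Pi.single f 1) • (f : E)) ω = L (Pi.single f 1) * I f ω := by
    refine ae_all_iff.2 fun f => ?_
    rw [map_smul]
    filter_upwards [Lp.coeFn_smul (L (Pi.single f 1)) (I f)] with ω h1
    rw [h1, Pi.smul_apply, smul_eq_mul]
  filter_upwards [this] with ω hω
  rw [Finset.sum_apply, Finset.sum_congr rfl fun f _ => hω f, Function.comp_apply,
    ← L.sum_comp_single]
  refine Finset.sum_congr rfl fun f _ => ?_
  rw [ContinuousLinearMap.comp_apply, ContinuousLinearMap.single_apply, mul_comm, ← smul_eq_mul,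
    ← map_smul]
  congr 1
  ext g
  by_cases hg : g = f
  · subst hg; simp
  · simp [hg]

/-! ### Density of step functions and the Wiener isometry -/

section Step

variable {S : Set ℝ}

theorem ind_of_le {t s : ℝ} (h : t ≤ s) : ind t s = 0 :=
  Set.indicator_of_notMem (fun h' => absurd h'.2 h.not_gt) _

theorem ind_of_lt {t s : ℝ} (h0 : 0 ≤ s) (h : s < t) : ind t s = 1 :=
  Set.indicator_of_mem (s := Set.Ico 0 t) ⟨h0, h⟩ _

theorem memLp_ind (t : ℝ) : MemLp (ind t) 2 (volume.restrict S) :=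
  (memLp_indicator_const 2 measurableSet_Ico (1 : ℝ) (Or.inr measure_Ico_lt_top.ne)).restrict S

/-- A function orthogonal to all 1_t has vanishing primitive, hence is zero by Lebesgue
differentiation. The predicate `p` allows fewer times, provided every other 1_t agrees on `S` with
an allowed one. -/
theorem span_ind_dense (hS : MeasurableSet S) (hS0 : S ⊆ Set.Ici 0) {p : ℝ≥0 → Prop}
    (hp : ∀ t : ℝ≥0, ∃ s : ℝ≥0, p s ∧ ind t =ᵐ[volume.restrict S] ind s) :
    (Submodule.span ℝ ((fun t : ℝ≥0 => (memLp_ind (S := S) t).toLp) '' {t | p t})).topologicalClosure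
      = ⊤ := by
  rw [Submodule.topologicalClosure_eq_top_iff, Submodule.eq_bot_iff]
  intro g hg
  have hg' (t : ℝ≥0) : ∫ x in S, ind t x * g x = 0 := by
    obtain ⟨s, hs, hts⟩ := hp t
    have := (Submodule.mem_orthogonal _ _).1 hg _ (Submodule.subset_span ⟨s, hs, rfl⟩)
    rw [L2.inner_def] at this
    rw [← this]
    refine integral_congr_ae ?_
    filter_upwards [hts, (memLp_ind (S := S) s).coeFn_toLp] with x h1 h2
    rw [h2, h1]
    simp [mul_comm]
  have hloc : LocallyIntegrable (S.indicator g) volume := by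
    refine MemLp.locallyIntegrable (p := 2) ?_ (by norm_num)
    exact (memLp_indicator_iff_restrict hS).2 (Lp.memLp g)
  have hz (t : ℝ) : ∫ x in (0 : ℝ)..t, S.indicator g x = 0 := by
    rcases le_total 0 t with ht | ht
    · lift t to ℝ≥0 using ht
      refine Eq.trans ?_ (hg' t)
      rw [← integral_indicator hS, intervalIntegral.integral_of_le t.coe_nonneg,
        ← integral_indicator measurableSet_Ioc]
      refine integral_congr_ae ?_
      -- The interval integral lives on (0,t] and 1_t on [0,t); the two endpoints are null.
      filter_upwards [Measure.ae_ne volume (t : ℝ), Measure.ae_ne volume 0] with x hxt hx0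
      simp only [Set.indicator, ind, Set.mem_Ioc, Set.mem_Ico, Pi.one_apply]
      by_cases h1 : x ∈ S
      · have hx : 0 < x := lt_of_le_of_ne (hS0 h1) hx0.symm
        by_cases h2 : x < t
        · simp [h1, h2, h2.le, hx, hx.le]
        · have : ¬ x ≤ t := fun h => h2 (lt_of_le_of_ne h hxt)
          simp [h1, h2, this]
      · simp [h1]
    · rw [intervalIntegral.integral_of_ge ht, ← integral_indicator measurableSet_Ioc, neg_eq_zero]
      refine integral_eq_zero_of_ae ?_
      filter_upwards [Measure.ae_ne volume 0] with x hx0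
      rw [Set.indicator_indicator, Set.indicator_of_notMem]
      · rfl
      · rintro ⟨h1, h2⟩
        exact hx0 (le_antisymm h1.2 (hS0 h2))
  have hae : S.indicator g =ᵐ[volume] 0 := by
    filter_upwards [_root_.LocallyIntegrable.ae_hasDerivAt_integral hloc] with x hx
    have := hx 0
    simp only [hz] at this
    exact this.unique (hasDerivAt_const x (0 : ℝ))
  refine Lp.ext ?_
  refine EventuallyEq.trans ?_ (Lp.coeFn_zero ℝ 2 _).symm
  filter_upwards [(ae_restrict_iff' hS).2 (hae.mono fun x hx hxS => hx), ae_restrict_mem hS]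
    with x h1 h2
  simpa [h2] using h1

/-- Lebesgue measure on the half-line. -/
noncomputable abbrev halfLine : Measure ℝ := volume.restrict (Set.Ici (0 : ℝ))

theorem span_ind_halfLine :
    (Submodule.span ℝ (Set.range fun t : ℝ≥0 =>
      (memLp_ind (S := Set.Ici 0) t).toLp)).topologicalClosure = ⊤ := by
  have := span_ind_dense (p := fun _ => True) measurableSet_Ici subset_rfl
    fun t => ⟨t, trivial, ae_eq_rfl⟩
  simpa using this

theorem span_ind_lebesgueOn (u : ℝ≥0) :
    (Submodule.span ℝ ((fun t : ℝ≥0 => (memLp_ind (S := Set.Icc (0 : ℝ) u) t).toLp) ''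
      {t | t ≤ u})).topologicalClosure = ⊤ := by
  refine span_ind_dense measurableSet_Icc Set.Icc_subset_Ici_self fun t => ?_
  refine ⟨min t u, min_le_right _ _, ?_⟩
  filter_upwards [ae_restrict_mem measurableSet_Icc, Measure.ae_ne (volume.restrict _) (u : ℝ)]
    with x hx hxu
  have hlt : x < u := lt_of_le_of_ne hx.2 hxu
  simp [ind, Set.indicator, hlt]

theorem integral_ind_mul_ind (s t : ℝ≥0) :
    ∫ x, ind s x * ind t x ∂halfLine = min s t := by
  have : (fun x => ind s x * ind t x) = (Set.Ico (0 : ℝ) (min s t)).indicator fun _ => 1 := by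
    ext x
    simp only [ind, Set.indicator, Set.mem_Ico, Pi.one_apply, lt_inf_iff]
    split_ifs <;> grind
  rw [this, integral_indicator measurableSet_Ico, Measure.restrict_restrict measurableSet_Ico,
    Set.inter_eq_left.2 Set.Ico_subset_Ici_self]
  simp

end Step

/-- The Wiener isometry of a Brownian motion. -/
theorem exists_wienerIsometry {Ω : Type*} [MeasurableSpace Ω] {P : Measure Ω}
    [IsProbabilityMeasure P] {W : ℝ≥0 → Ω → ℝ} (hW : IsPreBrownianReal W P) :
    ∃ I : Lp ℝ 2 halfLine →ₗᵢ[ℝ] Lp ℝ 2 P,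
      (∀ t : ℝ≥0, I ((memLp_ind (t : ℝ)).toLp) =ᵐ[P] W t) ∧
      (∀ f, ∫ ω, I f ω ∂P = 0) ∧
      IsGaussianProcess (fun f => ⇑(I f)) P := by
  have hm (t : ℝ≥0) : MemLp (W t) 2 P := (hW.isGaussianProcess.hasGaussianLaw_eval t).memLp_two
  obtain ⟨I, hI⟩ := exists_linearIsometry_of_inner_eq span_ind_halfLine
    (w := fun t => (hm t).toLp) fun s t => by
      rw [inner_toLp, inner_toLp, integral_ind_mul_ind, ← hW.covariance_eval,
        covariance_eq_sub (hm s) (hm t), hW.integral_eval, zero_mul, sub_zero]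
      rfl
  have hI' (t : ℝ≥0) : I ((memLp_ind (t : ℝ)).toLp) =ᵐ[P] W t := by
    rw [hI]; exact (hm t).coeFn_toLp
  have hlaw := hasLaw_linearIsometry hW.isGaussianProcess hW.integral_eval span_ind_halfLine I hI'
  refine ⟨I, hI', fun f => ?_, isGaussianProcess_linearIsometry I fun f => (hlaw f).hasGaussianLaw⟩
  rw [(hlaw f).integral_eq, integral_id_gaussianReal]

/-! ### Schur's test and bounded operators on L² -/

section Schur

variable {α : Type*} {mα : MeasurableSpace α} {μ : Measure α} [SFinite μ]

/-- Schur's test for nonnegative kernels. -/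
theorem lintegral_sq_lintegral_le_of_schur {k : α → α → ℝ≥0∞} (hk : Measurable (Function.uncurry k))
    {h : α → ℝ≥0∞} (hh : Measurable h) (h0 : ∀ᵐ x ∂μ, h x ≠ 0) (htop : ∀ᵐ x ∂μ, h x ≠ ∞)
    {A B : ℝ≥0∞} (hA : ∀ᵐ x ∂μ, ∫⁻ y, k x y * h y ∂μ ≤ A * h x)
    (hB : ∀ᵐ y ∂μ, ∫⁻ x, k x y * h x ∂μ ≤ B * h y) {F : α → ℝ≥0∞} (hF : AEMeasurable F μ) :
    ∫⁻ x, (∫⁻ y, k x y * F y ∂μ) ^ 2 ∂μ ≤ A * B * ∫⁻ y, F y ^ 2 ∂μ := by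
  wlog hFm : Measurable F generalizing F
  · have hae := hF.ae_eq_mk
    have e1 (x : α) : ∫⁻ y, k x y * F y ∂μ = ∫⁻ y, k x y * hF.mk F y ∂μ :=
      lintegral_congr_ae (hae.mono fun y hy => by simp only [hy])
    have e2 : ∫⁻ y, F y ^ 2 ∂μ = ∫⁻ y, hF.mk F y ^ 2 ∂μ :=
      lintegral_congr_ae (hae.mono fun y hy => by simp only [hy])
    simp only [e1, e2]
    exact this hF.measurable_mk.aemeasurable hF.measurable_mk
  have hkx (x : α) : Measurable (k x) := hk.of_uncurry_left
  have hky (y : α) : Measurable fun x => k x y := hk.of_uncurry_right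
  -- Cauchy–Schwarz for the splitting k F = (k h)^{1/2} · (k / h)^{1/2} F; the row bound controls
  -- the first factor, and the column bound is used after Tonelli.
  have key : ∀ᵐ x ∂μ, (∫⁻ y, k x y * F y ∂μ) ^ 2 ≤ A * h x * ∫⁻ y, k x y * (F y ^ 2 / h y) ∂μ := by
    filter_upwards [hA] with x hx
    have h2 : Real.HolderConjugate 2 2 := Real.holderConjugate_iff.2 (by norm_num)
    have hH := ENNReal.lintegral_mul_le_Lp_mul_Lq μ h2
      (f := fun y => (k x y * h y) ^ (1 / 2 : ℝ)) (g := fun y => (k x y / h y) ^ (1 / 2 : ℝ) * F y)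
      (((hkx x).mul hh).pow_const _).aemeasurable
      ((((hkx x).div hh).pow_const _).mul hFm).aemeasurable
    have e1 : ∫⁻ y, k x y * F y ∂μ = ∫⁻ y, ((fun y => (k x y * h y) ^ (1 / 2 : ℝ)) *
        fun y => (k x y / h y) ^ (1 / 2 : ℝ) * F y) y ∂μ := by
      refine lintegral_congr_ae ?_
      filter_upwards [h0, htop] with y h0y hty
      rw [Pi.mul_apply, ← mul_assoc, ← ENNReal.mul_rpow_of_nonneg _ _ (by norm_num)]
      congr 1
      have : k x y * h y * (k x y / h y) = k x y ^ (2 : ℝ) := by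
        rw [mul_assoc, ENNReal.mul_div_cancel h0y hty, ENNReal.rpow_two, sq]
      rw [this, ← ENNReal.rpow_mul]
      norm_num
    have e2 (y : α) : ((k x y * h y) ^ (1 / 2 : ℝ)) ^ (2 : ℝ) = k x y * h y := by
      rw [← ENNReal.rpow_mul]; norm_num
    have e3 (y : α) : ((k x y / h y) ^ (1 / 2 : ℝ) * F y) ^ (2 : ℝ) = k x y * (F y ^ 2 / h y) := by
      rw [ENNReal.mul_rpow_of_nonneg _ _ (by norm_num), ← ENNReal.rpow_mul, ENNReal.rpow_two]
      norm_num
      rw [div_eq_mul_inv, div_eq_mul_inv]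
      ring
    rw [← e1] at hH
    simp only [e2, e3] at hH
    calc _ ≤ ((∫⁻ y, k x y * h y ∂μ) ^ (1 / 2 : ℝ) *
          (∫⁻ y, k x y * (F y ^ 2 / h y) ∂μ) ^ (1 / 2 : ℝ)) ^ 2 := by gcongr
      _ = (∫⁻ y, k x y * h y ∂μ) * ∫⁻ y, k x y * (F y ^ 2 / h y) ∂μ := by
          rw [mul_pow, ← ENNReal.rpow_two, ← ENNReal.rpow_two, ← ENNReal.rpow_mul,
            ← ENNReal.rpow_mul]
          norm_num
      _ ≤ _ := by gcongr
  calc _ ≤ ∫⁻ x, A * h x * ∫⁻ y, k x y * (F y ^ 2 / h y) ∂μ ∂μ := lintegral_mono_ae key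
    _ = ∫⁻ x, ∫⁻ y, A * (F y ^ 2 / h y) * (k x y * h x) ∂μ ∂μ := by
        refine lintegral_congr fun x => ?_
        have : Measurable fun y => k x y * (F y ^ 2 / h y) := (hkx x).mul ((hFm.pow_const 2).div hh)
        rw [← lintegral_const_mul _ this]
        exact lintegral_congr fun y => by ring
    _ = ∫⁻ y, ∫⁻ x, A * (F y ^ 2 / h y) * (k x y * h x) ∂μ ∂μ := by
        refine lintegral_lintegral_swap (Measurable.aemeasurable ?_)
        exact ((((hFm.pow_const 2).div hh).const_mul A).comp measurable_snd).mul
          (hk.mul (hh.comp measurable_fst))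
    _ = ∫⁻ y, A * (F y ^ 2 / h y) * ∫⁻ x, k x y * h x ∂μ ∂μ :=
        lintegral_congr fun y => lintegral_const_mul _ ((hky y).mul hh)
    _ ≤ ∫⁻ y, A * B * F y ^ 2 ∂μ := by
        refine lintegral_mono_ae ?_
        filter_upwards [hB, h0, htop] with y hy h0y hty
        calc _ ≤ A * (F y ^ 2 / h y) * (B * h y) := by gcongr
          _ = A * B * (F y ^ 2 / h y * h y) := by ring
          _ = _ := by rw [ENNReal.div_mul_cancel h0y hty]
    _ = _ := lintegral_const_mul _ (hFm.pow_const 2)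

/-- `A` is the integral operator on `L²(μ)` with kernel `k`. -/
def IsIntegralOperator (μ : Measure α) (k : α → α → ℝ) (A : Lp ℝ 2 μ →L[ℝ] Lp ℝ 2 μ) : Prop :=
  ∀ f : Lp ℝ 2 μ, A f =ᵐ[μ] fun x => ∫ y, k x y * f y ∂μ

theorem exists_isIntegralOperator_of_schur {k : α → α → ℝ} (hk : Measurable (Function.uncurry k))
    {h : α → ℝ≥0∞} (hh : Measurable h) (h0 : ∀ᵐ x ∂μ, h x ≠ 0) (htop : ∀ᵐ x ∂μ, h x ≠ ∞)
    {A B : ℝ≥0} (hA : ∀ᵐ x ∂μ, ∫⁻ y, ‖k x y‖ₑ * h y ∂μ ≤ A * h x)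
    (hB : ∀ᵐ y ∂μ, ∫⁻ x, ‖k x y‖ₑ * h x ∂μ ≤ B * h y) :
    ∃ T : Lp ℝ 2 μ →L[ℝ] Lp ℝ 2 μ, IsIntegralOperator μ k T ∧ ‖T‖ ≤ Real.sqrt (A * B) := by
  have hkx (x : α) : Measurable (k x) := hk.of_uncurry_left
  have hsq (f : Lp ℝ 2 μ) : ∫⁻ x, (∫⁻ y, ‖k x y * f y‖ₑ ∂μ) ^ 2 ∂μ ≤ A * B * ‖f‖ₑ ^ 2 := by
    have := lintegral_sq_lintegral_le_of_schur (k := fun x y => ‖k x y‖ₑ) hk.enorm hh h0 htop hA hB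
      (Lp.aestronglyMeasurable f).enorm
    simp only [enorm_mul]
    refine this.trans_eq ?_
    rw [Lp.enorm_def, eLpNorm_eq_lintegral_rpow_enorm_toReal (by norm_num) (by norm_num)]
    congr 1
    rw [← ENNReal.rpow_natCast, ← ENNReal.rpow_mul]
    norm_num
  have hmeas (f : Lp ℝ 2 μ) : AEStronglyMeasurable (fun x => ∫ y, k x y * f y ∂μ) μ := by
    refine (StronglyMeasurable.integral_prod_right' (f := fun p : α × α => k p.1 p.2 * f p.2)
      ?_).aestronglyMeasurable
    exact hk.stronglyMeasurable.mul ((Lp.stronglyMeasurable f).comp_measurable measurable_snd)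
  have hnorm (f : Lp ℝ 2 μ) :
      eLpNorm (fun x => ∫ y, k x y * f y ∂μ) 2 μ ≤ ENNReal.ofReal (Real.sqrt (A * B)) * ‖f‖ₑ := by
    rw [eLpNorm_eq_lintegral_rpow_enorm_toReal (by norm_num) (by norm_num)]
    have e : ENNReal.ofReal (Real.sqrt (A * B)) * ‖f‖ₑ = (A * B * ‖f‖ₑ ^ 2) ^ (1 / 2 : ℝ) := by
      have : ENNReal.ofReal (Real.sqrt (A * B)) = (A * B : ℝ≥0∞) ^ (1 / 2 : ℝ) := by
        rw [Real.sqrt_eq_rpow, ← ENNReal.ofReal_rpow_of_nonneg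
          (by positivity) (by norm_num), ENNReal.ofReal_mul A.coe_nonneg]
        simp
      rw [this, ENNReal.mul_rpow_of_nonneg (_ * _) _ (by norm_num), ← ENNReal.rpow_natCast,
        ← ENNReal.rpow_mul]
      norm_num
    rw [e]
    norm_num
    refine ENNReal.rpow_le_rpow ((lintegral_mono fun x => ?_).trans (hsq f)) (by norm_num)
    gcongr
    exact enorm_integral_le_lintegral_enorm _
  -- Schur's bound applied to absolute values makes almost every row integral converge absolutely;
  -- additivity of the operator depends on this.
  have hint (f : Lp ℝ 2 μ) : ∀ᵐ x ∂μ, Integrable (fun y => k x y * f y) μ := by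
    have hlt : ∫⁻ x, (∫⁻ y, ‖k x y * f y‖ₑ ∂μ) ^ 2 ∂μ ≠ ∞ :=
      ((hsq f).trans_lt (by finiteness)).ne
    have hm : Measurable fun x => (∫⁻ y, ‖k x y * f y‖ₑ ∂μ) ^ 2 := by
      refine Measurable.pow_const (Measurable.lintegral_prod_right' (f := fun p : α × α =>
        ‖k p.1 p.2 * f p.2‖ₑ) ?_) 2
      exact (hk.mul ((Lp.stronglyMeasurable f).measurable.comp measurable_snd)).enorm
    filter_upwards [ae_lt_top hm hlt] with x hx
    refine ⟨(hkx x).aestronglyMeasurable.mul (Lp.aestronglyMeasurable f), ?_⟩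
    by_contra hc
    rw [HasFiniteIntegral, not_lt, top_le_iff] at hc
    rw [hc] at hx
    simp at hx
  have hmem (f : Lp ℝ 2 μ) : MemLp (fun x => ∫ y, k x y * f y ∂μ) 2 μ :=
    ⟨hmeas f, (hnorm f).trans_lt (by finiteness)⟩
  let T : Lp ℝ 2 μ →ₗ[ℝ] Lp ℝ 2 μ :=
    { toFun := fun f => (hmem f).toLp
      map_add' := fun f g => by
        rw [← MemLp.toLp_add, MemLp.toLp_eq_toLp_iff]
        filter_upwards [hint f, hint g] with x hf hg
        rw [Pi.add_apply, ← integral_add hf hg]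
        refine integral_congr_ae ?_
        filter_upwards [Lp.coeFn_add f g] with y hy
        rw [hy, Pi.add_apply, mul_add]
      map_smul' := fun c f => by
        rw [RingHom.id_apply, ← MemLp.toLp_const_smul, MemLp.toLp_eq_toLp_iff]
        refine Eventually.of_forall fun x => ?_
        simp only [Pi.smul_apply, smul_eq_mul]
        rw [← integral_const_mul]
        refine integral_congr_ae ?_
        filter_upwards [Lp.coeFn_smul c f] with y hy
        rw [hy, Pi.smul_apply, smul_eq_mul]
        ring }
  refine ⟨T.mkContinuous (Real.sqrt (A * B)) fun f => ?_, fun f => (hmem f).coeFn_toLp,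
    LinearMap.mkContinuous_norm_le _ (Real.sqrt_nonneg _) _⟩
  change ‖(hmem f).toLp‖ ≤ _
  rw [Lp.norm_toLp]
  refine (ENNReal.toReal_mono (by finiteness) (hnorm f)).trans_eq ?_
  rw [ENNReal.toReal_mul, ENNReal.toReal_ofReal (Real.sqrt_nonneg _), toReal_enorm]

end Schur

/-- Multiplication by a bounded function. -/
theorem exists_mulOperator {α : Type*} {mα : MeasurableSpace α} {μ : Measure α} {g : α → ℝ} (hg : Measurable g) {C : ℝ} (hC : ∀ᵐ x ∂μ, ‖g x‖ ≤ C) :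
    ∃ M : Lp ℝ 2 μ →L[ℝ] Lp ℝ 2 μ, ∀ f : Lp ℝ 2 μ, M f =ᵐ[μ] fun x => g x * f x := by
  have hle (f : Lp ℝ 2 μ) : ∀ᵐ x ∂μ, ‖g x * f x‖ ≤ C * ‖f x‖ := by
    filter_upwards [hC] with x hx
    rw [norm_mul]
    gcongr
  have hmem (f : Lp ℝ 2 μ) : MemLp (fun x => g x * f x) 2 μ :=
    (Lp.memLp f).of_le_mul (hg.aestronglyMeasurable.mul (Lp.aestronglyMeasurable f)) (hle f)
  let T : Lp ℝ 2 μ →ₗ[ℝ] Lp ℝ 2 μ :=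
    { toFun := fun f => (hmem f).toLp
      map_add' := fun f h => by
        rw [← MemLp.toLp_add, MemLp.toLp_eq_toLp_iff]
        filter_upwards [Lp.coeFn_add f h] with y hy
        rw [hy, Pi.add_apply, Pi.add_apply, mul_add]
      map_smul' := fun c f => by
        rw [RingHom.id_apply, ← MemLp.toLp_const_smul, MemLp.toLp_eq_toLp_iff]
        filter_upwards [Lp.coeFn_smul c f] with y hy
        rw [hy, Pi.smul_apply, Pi.smul_apply, smul_eq_mul, smul_eq_mul]
        ring }
  refine ⟨T.mkContinuous C fun f => ?_, fun f => (hmem f).coeFn_toLp⟩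
  refine Lp.norm_le_mul_norm_of_ae_le_mul ?_
  filter_upwards [(hmem f).coeFn_toLp, hle f] with x h1 h2
  change ‖(hmem f).toLp _ x‖ ≤ _
  rwa [h1]

/-! ### Beta and Gamma integrals of the Molchan–Golosov kernel -/

/-- The Molchan–Golosov integral kernel, so that `K_H(t,s) = c(H) ∫_0^t mgKernel (H - 1/2) s v dv`. -/
noncomputable def mgKernel (α s v : ℝ) : ℝ :=
  if 0 < s ∧ s < v then s ^ (-α) * v ^ α * (v - s) ^ (α - 1) else 0

theorem mgKernel_nonneg (α s v : ℝ) : 0 ≤ mgKernel α s v := by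
  unfold mgKernel
  split_ifs with h
  · have h1 : 0 < v := h.1.trans h.2
    have h2 : 0 < v - s := sub_pos.2 h.2
    have h3 := h.1
    positivity
  · exact le_rfl

theorem measurable_mgKernel (α : ℝ) : Measurable (Function.uncurry (mgKernel α)) := by
  refine Measurable.ite ?_ (by fun_prop) measurable_const
  exact (measurableSet_lt measurable_const measurable_fst).inter
    (measurableSet_lt measurable_fst measurable_snd)

theorem lintegral_beta {p q : ℝ} (hp : 0 < p) (hq : 0 < q) :
    ∫⁻ w in Set.Ioo (0 : ℝ) 1, ENNReal.ofReal (w ^ (p - 1) * (1 - w) ^ (q - 1)) =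
      ENNReal.ofReal (beta p q) := by
  have hb := beta_pos hp hq
  have h := lintegral_betaPDF_eq_one hp hq
  rw [lintegral_betaPDF] at h
  simp only [mul_assoc, ENNReal.ofReal_mul (one_div_pos.2 hb).le] at h
  rw [lintegral_const_mul' _ _ (by finiteness)] at h
  calc _ = ENNReal.ofReal (beta p q) * (ENNReal.ofReal (1 / beta p q) *
        ∫⁻ w in Set.Ioo (0 : ℝ) 1, ENNReal.ofReal (w ^ (p - 1) * (1 - w) ^ (q - 1))) := by
        rw [← mul_assoc, ← ENNReal.ofReal_mul hb.le, mul_one_div_cancel hb.ne', ENNReal.ofReal_one,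
          one_mul]
    _ = _ := by rw [h, mul_one]

/-- This compares the integrands in the Beta substitution, with A = x - s, B = y - s, D = y - x. All
quantities are positive, so after taking logarithms it is a linear identity. -/
theorem rpow_beta_identity {α s x y A B D : ℝ} (hs : 0 < s) (hx : 0 < x) (hy : 0 < y) (hA : 0 < A)
    (hB : 0 < B) (hD : 0 < D) :
    y * D / (x * (B * B)) * ((y * A / (x * B)) ^ (α - 1) * (s * D / (x * B)) ^ (1 - 2 * α - 1)) =
      D ^ (1 - 2 * α) * ((s ^ (-α) * x ^ α * A ^ (α - 1)) * (s ^ (-α) * y ^ α * B ^ (α - 1))) := by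
  rw [← Real.exp_log hs, ← Real.exp_log hx, ← Real.exp_log hy, ← Real.exp_log hA,
    ← Real.exp_log hB, ← Real.exp_log hD]
  simp only [← Real.exp_mul, ← Real.exp_add, ← Real.exp_sub]
  congr 1
  ring

/-- The substitution w = y(x - s) / (x(y - s)) maps (0,x) decreasingly onto (0,1), with 1 - w = s(y
- x) / (x(y - s)), and turns the integral into a Beta integral times a power of y - x. -/
theorem lintegral_mgKernel_mul_mgKernel {α x y : ℝ} (hα : 0 < α) (hα' : α < 1 / 2) (hx : 0 < x)
    (hxy : x < y) :
    ∫⁻ s, ENNReal.ofReal (mgKernel α s x * mgKernel α s y) =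
      ENNReal.ofReal (beta α (1 - 2 * α) * (y - x) ^ (2 * α - 1)) := by
  have hy : 0 < y := hx.trans hxy
  have hD : 0 < y - x := sub_pos.2 hxy
  set f : ℝ → ℝ := fun s => y * (x - s) / (x * (y - s)) with hf
  have himg : f '' Set.Ioo 0 x = Set.Ioo 0 1 := by
    ext w
    constructor
    · rintro ⟨s, ⟨h1, h2⟩, rfl⟩
      have h3 : 0 < x - s := sub_pos.2 h2
      have h4 : 0 < y - s := by linarith
      refine ⟨by simp only [hf]; positivity, ?_⟩
      simp only [hf]
      rw [div_lt_one (by positivity)]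
      nlinarith
    · rintro ⟨h1, h2⟩
      have h3 : 0 < y - w * x := by nlinarith
      have h4 : 0 < 1 - w := by linarith
      -- The preimage comes from solving w x (y - s) = y (x - s) for s.
      refine ⟨x * y * (1 - w) / (y - w * x), ⟨by positivity, ?_⟩, ?_⟩
      · rw [div_lt_iff₀ h3]
        nlinarith [mul_pos (mul_pos hx h1) hD]
      · have e1 : x - x * y * (1 - w) / (y - w * x) = x * w * (y - x) / (y - w * x) := by
          rw [eq_div_iff h3.ne', sub_mul, div_mul_cancel₀ _ h3.ne']; ring
        have e2 : y - x * y * (1 - w) / (y - w * x) = y * (y - x) / (y - w * x) := by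
          rw [eq_div_iff h3.ne', sub_mul, div_mul_cancel₀ _ h3.ne']; ring
        simp only [hf, e1, e2]
        rw [mul_div_assoc', mul_div_assoc', div_div_div_cancel_right₀ h3.ne']
        field_simp
  have hder : ∀ s ∈ Set.Ioo 0 x, HasDerivWithinAt f (-(y * (y - x) / (x * ((y - s) * (y - s)))))
      (Set.Ioo 0 x) s := by
    rintro s ⟨h1, h2⟩
    have h4 : 0 < y - s := by linarith
    have hd1 : HasDerivAt (fun s => y * (x - s)) (y * -1) s :=
      ((hasDerivAt_id s).const_sub x).const_mul y
    have hd2 : HasDerivAt (fun s => x * (y - s)) (x * -1) s :=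
      ((hasDerivAt_id s).const_sub y).const_mul x
    refine (hd1.div hd2 (by positivity)).hasDerivWithinAt.congr_deriv ?_
    field_simp
    ring
  have hinj : Set.InjOn f (Set.Ioo 0 x) := by
    rintro s ⟨h1, h2⟩ r ⟨h3, h4⟩ h
    have h5 : 0 < y - s := by linarith
    have h6 : 0 < y - r := by linarith
    simp only [hf] at h
    rw [div_eq_div_iff (by positivity) (by positivity)] at h
    have h7 : y * x * (y - x) * (s - r) = 0 := by linear_combination -h
    have h8 : y * x * (y - x) ≠ 0 := by positivity
    exact sub_eq_zero.1 ((mul_eq_zero.1 h7).resolve_left h8)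
  have hcv := lintegral_image_eq_lintegral_abs_deriv_mul measurableSet_Ioo hder hinj
    fun w => ENNReal.ofReal (w ^ (α - 1) * (1 - w) ^ (1 - 2 * α - 1))
  rw [himg, lintegral_beta hα (by linarith)] at hcv
  have hpt : ∀ s ∈ Set.Ioo 0 x, ENNReal.ofReal |-(y * (y - x) / (x * ((y - s) * (y - s))))| *
      ENNReal.ofReal (f s ^ (α - 1) * (1 - f s) ^ (1 - 2 * α - 1)) =
      ENNReal.ofReal ((y - x) ^ (1 - 2 * α)) *
        ENNReal.ofReal (mgKernel α s x * mgKernel α s y) := by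
    rintro s ⟨h1, h2⟩
    have h3 : 0 < x - s := by linarith
    have h4 : 0 < y - s := by linarith
    have e : 1 - f s = s * (y - x) / (x * (y - s)) := by
      simp only [hf]; field_simp; ring
    rw [← ENNReal.ofReal_mul (abs_nonneg _), ← ENNReal.ofReal_mul (by positivity), abs_neg,
      abs_of_pos (by positivity), e]
    congr 1
    simp only [hf]
    rw [mgKernel, mgKernel, if_pos ⟨h1, h2⟩, if_pos ⟨h1, h2.trans hxy⟩]
    exact rpow_beta_identity h1 hx hy h3 h4 hD
  rw [setLIntegral_congr_fun measurableSet_Ioo hpt, lintegral_const_mul' _ _ (by finiteness)] at hcv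
  have hset : ∫⁻ s in Set.Ioo 0 x, ENNReal.ofReal (mgKernel α s x * mgKernel α s y) =
      ∫⁻ s, ENNReal.ofReal (mgKernel α s x * mgKernel α s y) := by
    refine setLIntegral_eq_of_support_subset ?_
    intro s hs
    by_contra hc
    rw [Set.mem_Ioo] at hc
    simp [mgKernel, hc] at hs
  rw [hset] at hcv
  rw [mul_comm, ENNReal.ofReal_mul (by positivity), hcv, ← mul_assoc,
    ← ENNReal.ofReal_mul (by positivity), ← Real.rpow_add hD]
  simp

/-- Scaling s = v w cancels every power of v. The singularity s^{-2α} is integrable because α < 1/2.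
This is the column bound in Schur's test with weight s^{-α}. -/
theorem lintegral_mgKernel_mul_rpow {α v : ℝ} (hα : 0 < α) (hα' : α < 1 / 2) (hv : 0 < v) :
    ∫⁻ s, ENNReal.ofReal (mgKernel α s v * s ^ (-α)) = ENNReal.ofReal (beta (1 - 2 * α) α) := by
  have himg : (fun w => v * w) '' Set.Ioo 0 1 = Set.Ioo 0 v := by
    simp [Set.image_mul_left_Ioo hv]
  have hset : ∫⁻ s in Set.Ioo 0 v, ENNReal.ofReal (mgKernel α s v * s ^ (-α)) =
      ∫⁻ s, ENNReal.ofReal (mgKernel α s v * s ^ (-α)) := by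
    refine setLIntegral_eq_of_support_subset ?_
    intro s hs
    by_contra hc
    rw [Set.mem_Ioo] at hc
    simp [mgKernel, hc] at hs
  rw [← hset, ← himg, lintegral_image_eq_lintegral_abs_deriv_mul (f' := fun _ => v)
    measurableSet_Ioo (fun w _ => by simpa using ((hasDerivAt_id w).const_mul v).hasDerivWithinAt)
    (fun a _ b _ h => mul_left_cancel₀ hv.ne' h), ← lintegral_beta (by linarith) hα]
  refine setLIntegral_congr_fun measurableSet_Ioo ?_
  rintro w ⟨h1, h2⟩
  have h3 : 0 < 1 - w := by linarith
  have h4 : v * w < v := by nlinarith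
  simp only
  rw [← ENNReal.ofReal_mul (abs_nonneg _), mgKernel, if_pos ⟨by positivity, h4⟩, abs_of_pos hv,
    show v - v * w = v * (1 - w) by ring]
  congr 1
  rw [← Real.exp_log h1, ← Real.exp_log hv]
  rw [Real.exp_log h1, ← Real.exp_log h3]
  rw [← Real.exp_log h1]
  simp only [← Real.exp_mul, ← Real.exp_add]
  congr 1
  ring

/-- The weight v^{-α} cancels the factor v^α of the kernel, leaving a multiple of the Gamma density
shifted by s. This is the row bound in Schur's test, and its decay in r drives the invertibility
argument. -/
theorem lintegral_mgKernel_mul_exp_le {α s r : ℝ} (hα : 0 < α) (hs : 0 < s) (hr : 0 < r) :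
    ∫⁻ v, ENNReal.ofReal (mgKernel α s v * Real.exp (-(r * (v - s))) * v ^ (-α)) ≤
      ENNReal.ofReal (Real.Gamma α / r ^ α * s ^ (-α)) := by
  have hΓ := Real.Gamma_pos_of_pos hα
  have h := lintegral_gammaPDF_eq_one hα hr
  rw [← lintegral_sub_right_eq_self _ s] at h
  calc _ ≤ ∫⁻ v, ENNReal.ofReal (Real.Gamma α / r ^ α * s ^ (-α)) * gammaPDF α r (v - s) := by
        refine lintegral_mono fun v => ?_
        by_cases hv : s < v
        · have h1 : 0 < v - s := sub_pos.2 hv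
          have h2 : 0 < v := hs.trans hv
          rw [gammaPDF_of_nonneg h1.le, ← ENNReal.ofReal_mul (by positivity), mgKernel,
            if_pos ⟨hs, hv⟩]
          refine ENNReal.ofReal_le_ofReal (le_of_eq ?_)
          have h3 : v ^ α * v ^ (-α) = 1 := by rw [← Real.rpow_add h2]; simp
          have h4 : r ^ α ≠ 0 := by positivity
          calc _ = s ^ (-α) * (v - s) ^ (α - 1) * Real.exp (-(r * (v - s))) *
                (v ^ α * v ^ (-α)) := by ring
            _ = _ := by rw [h3]; field_simp
        · simp [mgKernel, hv]
    _ = _ := by rw [lintegral_const_mul' _ _ (by finiteness), h, mul_one]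

/-! ### Invertibility of the Volterra operator -/

section Operator

variable {u : ℝ≥0}

theorem ae_pos_lebesgueOn : ∀ᵐ x ∂lebesgueOn u, 0 < x := by
  filter_upwards [ae_restrict_mem measurableSet_Icc, Measure.ae_ne (volume.restrict _) (0 : ℝ)]
    with x hx hx0
  exact lt_of_le_of_ne hx.1 hx0.symm

/-- Schur's test with weight s^{-α}: the damping makes the row constant of order r^{-α}, while the
column constant does not depend on r, so the norm bound tends to 0 as r grows. -/
theorem exists_isIntegralOperator_mgKernel {α r : ℝ} (hα : 0 < α) (hα' : α < 1 / 2) (hr : 0 < r) :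
    ∃ T : L2 u →L[ℝ] L2 u,
      IsIntegralOperator (lebesgueOn u) (fun s v => mgKernel α s v * Real.exp (-(r * (v - s)))) T ∧
      ‖T‖ ≤ Real.sqrt (Real.Gamma α / r ^ α * (beta (1 - 2 * α) α * (u : ℝ) ^ α)) := by
  have hΓ := Real.Gamma_pos_of_pos hα
  have hb : 0 < beta (1 - 2 * α) α := beta_pos (by linarith) hα
  have hmeas : Measurable (Function.uncurry fun s v =>
      mgKernel α s v * Real.exp (-(r * (v - s)))) :=
    (measurable_mgKernel α).mul (by fun_prop)
  have henorm (s v : ℝ) : ‖mgKernel α s v * Real.exp (-(r * (v - s)))‖ₑ =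
      ENNReal.ofReal (mgKernel α s v * Real.exp (-(r * (v - s)))) :=
    Real.enorm_of_nonneg (mul_nonneg (mgKernel_nonneg α s v) (Real.exp_nonneg _))
  have hk0 (s v : ℝ) : 0 ≤ mgKernel α s v * Real.exp (-(r * (v - s))) :=
    mul_nonneg (mgKernel_nonneg α s v) (Real.exp_nonneg _)
  obtain ⟨T, hT, hTn⟩ := exists_isIntegralOperator_of_schur (μ := lebesgueOn u)
    (A := (Real.Gamma α / r ^ α).toNNReal) (B := (beta (1 - 2 * α) α * (u : ℝ) ^ α).toNNReal)
    hmeas (h := fun s => ENNReal.ofReal (s ^ (-α))) (by fun_prop)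
    (ae_pos_lebesgueOn.mono fun s hs => by simpa using Real.rpow_pos_of_pos hs _)
    (Eventually.of_forall fun s => by simp)
    (ae_pos_lebesgueOn.mono fun s hs => by
      simp only [henorm, ← ENNReal.ofReal_mul (hk0 _ _)]
      refine (lintegral_mono' Measure.restrict_le_self le_rfl).trans
        ((lintegral_mgKernel_mul_exp_le hα hs hr).trans_eq ?_)
      rw [ENNReal.ofReal_mul (by positivity)]
      rfl)
    (by
      filter_upwards [ae_pos_lebesgueOn, ae_restrict_mem measurableSet_Icc] with v hv hvu
      simp only [henorm, ← ENNReal.ofReal_mul (hk0 _ _)]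
      calc _ ≤ ∫⁻ s, ENNReal.ofReal (mgKernel α s v * s ^ (-α)) := by
            refine (lintegral_mono' Measure.restrict_le_self le_rfl).trans
              (lintegral_mono fun s => ENNReal.ofReal_le_ofReal ?_)
            by_cases h : 0 < s ∧ s < v
            · have h1 : 0 ≤ s ^ (-α) := (Real.rpow_pos_of_pos h.1 _).le
              refine mul_le_mul_of_nonneg_right (mul_le_of_le_one_right (mgKernel_nonneg _ _ _) ?_) h1
              rw [Real.exp_le_one_iff]
              nlinarith [h.2]
            · simp [mgKernel, h]
        _ = ENNReal.ofReal (beta (1 - 2 * α) α) := lintegral_mgKernel_mul_rpow hα hα' hv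
        -- The test needs a multiple of the weight; v ≤ u gives 1 ≤ u^α v^{-α}.
        _ ≤ ENNReal.ofReal (beta (1 - 2 * α) α * (u : ℝ) ^ α * v ^ (-α)) := by
            refine ENNReal.ofReal_le_ofReal ?_
            rw [mul_assoc]
            refine le_mul_of_one_le_right hb.le ?_
            rw [Real.rpow_neg hv.le, ← div_eq_mul_inv, one_le_div (Real.rpow_pos_of_pos hv _)]
            exact Real.rpow_le_rpow hv.le hvu.2 hα.le
        _ = _ := by
            rw [ENNReal.ofReal_mul (by positivity)]
            rfl)
  refine ⟨T, hT, hTn.trans_eq ?_⟩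
  rw [Real.coe_toNNReal _ (by positivity), Real.coe_toNNReal _ (by positivity)]

/-- Volterra operators of Molchan–Golosov type are quasi-nilpotent: `a + b T` is invertible. -/
theorem exists_equiv_add_mgKernel {α a b : ℝ} (hα : 0 < α) (hα' : α < 1 / 2) (ha : a ≠ 0) :
    ∃ A : L2 u ≃L[ℝ] L2 u, ∀ f : L2 u,
      A f =ᵐ[lebesgueOn u] fun s => a * f s + b * ∫ v, mgKernel α s v * f v ∂lebesgueOn u := by
  have hlim : Tendsto (fun r : ℝ => ‖a⁻¹ * b‖ * Real.sqrt (Real.Gamma α / r ^ α *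
      (beta (1 - 2 * α) α * (u : ℝ) ^ α))) atTop (𝓝 0) := by
    have h1 : Tendsto (fun r : ℝ => Real.Gamma α / r ^ α) atTop (𝓝 0) :=
      (tendsto_rpow_atTop hα).const_div_atTop _
    have h2 := ((h1.mul_const (beta (1 - 2 * α) α * (u : ℝ) ^ α)).sqrt).const_mul ‖a⁻¹ * b‖
    simpa using h2
  obtain ⟨r, hr1, hr⟩ := ((hlim.eventually (gt_mem_nhds zero_lt_one)).and
    (eventually_gt_atTop 0)).exists
  obtain ⟨T, hT, hTn⟩ := exists_isIntegralOperator_mgKernel (u := u) hα hα' hr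
  have hunit : IsUnit (1 - -((a⁻¹ * b) • T)) := by
    refine isUnit_one_sub_of_norm_lt_one ?_
    rw [norm_neg, norm_smul]
    exact (mul_le_mul_of_nonneg_left hTn (norm_nonneg _)).trans_lt hr1
  obtain ⟨M, hM⟩ := exists_mulOperator (μ := lebesgueOn u) (g := fun x => Real.exp (-(r * x)))
    (by fun_prop) (C := 1) (by
      filter_upwards [ae_restrict_mem measurableSet_Icc] with x hx
      rw [Real.norm_of_nonneg (Real.exp_nonneg _), Real.exp_le_one_iff]
      nlinarith [hx.1])
  obtain ⟨N, hN⟩ := exists_mulOperator (μ := lebesgueOn u) (g := fun x => Real.exp (r * x))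
    (by fun_prop) (C := Real.exp (r * u)) (by
      filter_upwards [ae_restrict_mem measurableSet_Icc] with x hx
      rw [Real.norm_of_nonneg (Real.exp_nonneg _), Real.exp_le_exp]
      exact mul_le_mul_of_nonneg_left hx.2 hr.le)
  have hMN : M * N = 1 := by
    ext1 f
    refine Lp.ext ?_
    filter_upwards [hM (N f), hN f] with x h1 h2
    rw [mul_apply_eq_comp, h1, h2, ← mul_assoc, ← Real.exp_add]
    simp
  have hNM : N * M = 1 := by
    ext1 f
    refine Lp.ext ?_
    filter_upwards [hN (M f), hM f] with x h1 h2
    rw [mul_apply_eq_comp, h1, h2, ← mul_assoc, ← Real.exp_add]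
    simp
  -- With M = e^{-rx} and N = e^{rx}, conjugation removes the damping: M T N is the undamped
  -- operator. The middle factor is invertible by the Neumann series.
  have hA : IsUnit (a • (M * (1 - -((a⁻¹ * b) • T)) * N)) := by
    refine IsUnit.smul (Units.mk0 a ha) ((IsUnit.mul ?_ hunit).mul ?_)
    exacts [⟨⟨M, N, hMN, hNM⟩, rfl⟩, ⟨⟨N, M, hNM, hMN⟩, rfl⟩]
  refine ⟨ContinuousLinearEquiv.unitsEquiv ℝ _ hA.unit, fun f => ?_⟩
  change (a • M (N f - -((a⁻¹ * b) • T (N f))) : L2 u) =ᵐ[lebesgueOn u] _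
  rw [sub_neg_eq_add]
  filter_upwards [Lp.coeFn_smul a (M (N f + (a⁻¹ * b) • T (N f))),
    hM (N f + (a⁻¹ * b) • T (N f)), Lp.coeFn_add (N f) ((a⁻¹ * b) • T (N f)),
    Lp.coeFn_smul (a⁻¹ * b) (T (N f)), hN f, hT (N f)] with s h1 h2 h3 h4 h5 h6
  rw [h1, Pi.smul_apply, h2, h3, Pi.add_apply, h4, Pi.smul_apply, h5, h6, smul_eq_mul, smul_eq_mul]
  have h7 : ∫ v, mgKernel α s v * Real.exp (-(r * (v - s))) * N f v ∂lebesgueOn u =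
      Real.exp (r * s) * ∫ v, mgKernel α s v * f v ∂lebesgueOn u := by
    rw [← integral_const_mul]
    refine integral_congr_ae ?_
    filter_upwards [hN f] with v hv
    rw [hv]
    have : Real.exp (-(r * (v - s))) * Real.exp (r * v) = Real.exp (r * s) := by
      rw [← Real.exp_add]; congr 1; ring
    rw [← this]
    ring
  rw [h7]
  have h8 : Real.exp (-(r * s)) * Real.exp (r * s) = 1 := by
    rw [← Real.exp_add]; simp
  calc _ = (Real.exp (-(r * s)) * Real.exp (r * s)) *
        (a * f s + a * a⁻¹ * b * ∫ v, mgKernel α s v * f v ∂lebesgueOn u) := by ring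
    _ = _ := by rw [h8, mul_inv_cancel₀ ha]; ring

end Operator

theorem lintegral_Ioo_ofReal_eq {f : ℝ → ℝ} {x y : ℝ} (hxy : x ≤ y)
    (hf : IntervalIntegrable f volume x y) (h0 : ∀ v ∈ Set.Ioo x y, 0 ≤ f v) :
    ∫⁻ v in Set.Ioo x y, ENNReal.ofReal (f v) = ENNReal.ofReal (∫ v in x..y, f v) := by
  rw [intervalIntegral.integral_of_le hxy, integral_Ioc_eq_integral_Ioo,
    ofReal_integral_eq_lintegral_ofReal]
  · exact ((intervalIntegrable_iff_integrableOn_Ioc_of_le hxy).1 hf).mono_set Set.Ioo_subset_Ioc_self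
  · filter_upwards [ae_restrict_mem measurableSet_Ioo] with v hv using h0 v hv

/-! ### The kernel K_H and the covariance of fractional Brownian motion -/

section Kernel

variable {H : ℝ}

theorem c_pos (hH : 1 / 2 < H) (hH1 : H < 1) : 0 < c H := by
  have h1 := Real.Gamma_pos_of_pos (show 0 < 3 / 2 - H by linarith)
  have h2 := Real.Gamma_pos_of_pos (show 0 < H + 1 / 2 by linarith)
  have h3 := Real.Gamma_pos_of_pos (show 0 < 2 - 2 * H by linarith)
  have h4 : 0 < H - 1 / 2 := by linarith
  unfold c
  have : 0 < H := by linarith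
  positivity

/-- The normalization behind `c`: H(2H - 1)|x - y|^{2H-2} is the mixed second derivative of the
fractional covariance, and the Beta factor arises from integrating out s. The Gamma factors cancel
by Γ(H + 1/2) = (H - 1/2) Γ(H - 1/2). -/
theorem c_sq_mul_beta (hH : 1 / 2 < H) (hH1 : H < 1) :
    c H ^ 2 * beta (H - 1 / 2) (1 - 2 * (H - 1 / 2)) = H * (2 * H - 1) := by
  have h1 := Real.Gamma_pos_of_pos (show 0 < 3 / 2 - H by linarith)
  have h2 := Real.Gamma_pos_of_pos (show 0 < H - 1 / 2 by linarith)
  have h3 := Real.Gamma_pos_of_pos (show 0 < 2 - 2 * H by linarith)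
  have h4 : 0 < H - 1 / 2 := by linarith
  have h5 : 0 < H := by linarith
  have h6 : Real.Gamma (H + 1 / 2) = (H - 1 / 2) * Real.Gamma (H - 1 / 2) := by
    rw [← Real.Gamma_add_one h4.ne']
    congr 1; ring
  unfold c beta
  rw [h6, mul_pow, Real.sq_sqrt (by positivity), show 1 - 2 * (H - 1 / 2) = 2 - 2 * H by ring,
    show H - 1 / 2 + (2 - 2 * H) = 3 / 2 - H by ring]
  generalize Real.Gamma (3 / 2 - H) = g1 at *
  generalize Real.Gamma (H - 1 / 2) = g2 at *
  generalize Real.Gamma (2 - 2 * H) = g3 at *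
  field_simp

theorem intervalIntegrable_kernel (hH : 1 / 2 < H) {s t : ℝ} (hs : 0 < s) (hst : s ≤ t) :
    IntervalIntegrable (fun v => v ^ (H - 1 / 2) / (v - s) ^ (3 / 2 - H)) volume s t := by
  have h1 : IntervalIntegrable (fun v => (v - s) ^ (H - 3 / 2)) volume s t := by
    have := (intervalIntegral.intervalIntegrable_rpow' (a := 0) (b := t - s)
      (show -1 < H - 3 / 2 by linarith)).comp_sub_right s
    simpa using this
  have h2 : ContinuousOn (fun v : ℝ => v ^ (H - 1 / 2)) (Set.uIcc s t) := by
    refine ContinuousOn.rpow_const continuousOn_id fun v hv => Or.inl ?_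
    rw [Set.uIcc_of_le hst] at hv
    exact (hs.trans_le hv.1).ne'
  refine (h1.continuousOn_mul h2).congr fun v hv => ?_
  rw [Set.uIoc_of_le hst] at hv
  have e : (v - s) ^ (H - 3 / 2) = ((v - s) ^ (3 / 2 - H))⁻¹ := by
    rw [← Real.rpow_neg (by linarith [hv.1]), neg_sub]
  simp only [e]
  exact (div_eq_mul_inv _ _).symm

theorem mgKernel_eq_div {s v : ℝ} (hs : 0 < s) (hsv : s < v) :
    mgKernel (H - 1 / 2) s v =
      1 / s ^ (H - 1 / 2) * (v ^ (H - 1 / 2) / (v - s) ^ (3 / 2 - H)) := by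
  have e : (v - s) ^ (H - 1 / 2 - 1) = ((v - s) ^ (3 / 2 - H))⁻¹ := by
    rw [← Real.rpow_neg (by linarith)]
    congr 1; ring
  rw [mgKernel, if_pos ⟨hs, hsv⟩, Real.rpow_neg hs.le, e]
  ring

theorem integrableOn_mgKernel (hH : 1 / 2 < H) {s : ℝ} (hs : 0 < s) (t : ℝ) :
    IntegrableOn (mgKernel (H - 1 / 2) s) (Set.Ioo 0 t) := by
  have hsub : IntegrableOn (mgKernel (H - 1 / 2) s) (Set.Ioo s t) := by
    rcases le_total s t with hst | hst
    · have := (((intervalIntegrable_kernel hH hs hst).const_mul (1 / s ^ (H - 1 / 2))).1).mono_set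
        Set.Ioo_subset_Ioc_self
      exact this.congr_fun (fun v hv => (mgKernel_eq_div hs hv.1).symm) measurableSet_Ioo
    · rw [Set.Ioo_eq_empty (not_lt.2 hst)]
      exact integrableOn_empty
  refine hsub.of_forall_sdiff_eq_zero measurableSet_Ioo fun v hv => ?_
  rw [mgKernel, if_neg]
  rintro ⟨-, h⟩
  exact hv.2 ⟨h, hv.1.2⟩

/-- The kernel vanishes for v ≤ s, so the domain (0,t) no longer depends on s and the case s ≥ t
needs no separate treatment. In this form K_H(t,·) is c(H) times the integral operator applied to
1_t. -/
theorem KH_eq_integral_mgKernel {s : ℝ} (hs : 0 < s) (t : ℝ) :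
    KH H t s = c H * ∫ v in Set.Ioo 0 t, mgKernel (H - 1 / 2) s v := by
  unfold KH
  split_ifs with hst
  · rw [mul_assoc, intervalIntegral.integral_of_le hst.le, integral_Ioc_eq_integral_Ioo,
      ← integral_const_mul, setIntegral_congr_fun measurableSet_Ioo
        fun v hv => (mgKernel_eq_div hs hv.1).symm]
    congr 1
    refine (setIntegral_eq_of_subset_of_forall_sdiff_eq_zero measurableSet_Ioo
      (Set.Ioo_subset_Ioo_left hs.le) fun v hv => ?_).symm
    rw [mgKernel, if_neg]
    rintro ⟨-, h⟩
    exact hv.2 ⟨h, hv.1.2⟩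
  · rw [setIntegral_eq_zero_of_forall_eq_zero, mul_zero]
    intro v hv
    rw [mgKernel, if_neg]
    rintro ⟨-, h⟩
    exact hst (h.trans hv.2)

theorem KH_nonneg (hH : 1 / 2 < H) (hH1 : H < 1) {s : ℝ} (hs : 0 < s) (t : ℝ) : 0 ≤ KH H t s := by
  rw [KH_eq_integral_mgKernel hs]
  exact mul_nonneg (c_pos hH hH1).le (integral_nonneg fun v => mgKernel_nonneg _ _ _)

theorem KH_of_le {s t : ℝ} (h : t ≤ s) : KH H t s = 0 := if_neg h.not_gt

theorem ae_pos_halfLine : ∀ᵐ s ∂halfLine, 0 < s := by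
  filter_upwards [ae_restrict_mem measurableSet_Ici, Measure.ae_ne (volume.restrict _) (0 : ℝ)]
    with s hs h0 using lt_of_le_of_ne hs h0.symm

theorem aestronglyMeasurable_KH (t : ℝ) :
    AEStronglyMeasurable (KH H t) halfLine := by
  have h : StronglyMeasurable fun s => c H * ∫ v in Set.Ioo 0 t, mgKernel (H - 1 / 2) s v :=
    (StronglyMeasurable.integral_prod_right'
      (measurable_mgKernel (H - 1 / 2)).stronglyMeasurable).const_mul _
  exact h.aestronglyMeasurable.congr
    (ae_pos_halfLine.mono fun s hs => (KH_eq_integral_mgKernel hs t).symm)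

theorem ofReal_KH (hH : 1 / 2 < H) (hH1 : H < 1) {s : ℝ} (hs : 0 < s) (t : ℝ) :
    ENNReal.ofReal (KH H t s) = ENNReal.ofReal (c H) *
      ∫⁻ v in Set.Ioo 0 t, ENNReal.ofReal (mgKernel (H - 1 / 2) s v) := by
  rw [KH_eq_integral_mgKernel hs, ENNReal.ofReal_mul (c_pos hH hH1).le,
    ofReal_integral_eq_lintegral_ofReal (integrableOn_mgKernel hH hs t)
      (Eventually.of_forall fun v => mgKernel_nonneg _ _ _)]

theorem lintegral_mgKernel_mul_mgKernel_abs {α x y : ℝ} (hα : 0 < α) (hα' : α < 1 / 2) (hx : 0 < x)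
    (hy : 0 < y) (hxy : x ≠ y) :
    ∫⁻ s, ENNReal.ofReal (mgKernel α s x) * ENNReal.ofReal (mgKernel α s y) =
      ENNReal.ofReal (beta α (1 - 2 * α)) * ENNReal.ofReal (|x - y| ^ (2 * α - 1)) := by
  simp only [← ENNReal.ofReal_mul (mgKernel_nonneg _ _ _)]
  rw [← ENNReal.ofReal_mul (beta_pos hα (by linarith)).le]
  rcases lt_or_gt_of_ne hxy with h | h
  · rw [lintegral_mgKernel_mul_mgKernel hα hα' hx h, abs_sub_comm, abs_of_pos (sub_pos.2 h)]
  · simp only [mul_comm (mgKernel α _ x)]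
    rw [lintegral_mgKernel_mul_mgKernel hα hα' hy h, abs_of_pos (sub_pos.2 h)]

theorem lintegral_abs_sub_rpow {q x r : ℝ} (hq : -1 < q) (hx : 0 < x) (hxr : x ≤ r) :
    ∫⁻ y in Set.Ioo 0 r, ENNReal.ofReal (|x - y| ^ q) =
      ENNReal.ofReal ((x ^ (q + 1) + (r - x) ^ (q + 1)) / (q + 1)) := by
  have hq' : q + 1 ≠ 0 := by linarith
  have i1 : IntervalIntegrable (fun y => (x - y) ^ q) volume 0 x := by
    have := (intervalIntegral.intervalIntegrable_rpow' (a := x) (b := 0) hq).comp_sub_left x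
    simpa using this
  have i2 : IntervalIntegrable (fun y => (y - x) ^ q) volume x r := by
    have := (intervalIntegral.intervalIntegrable_rpow' (a := 0) (b := r - x) hq).comp_sub_right x
    simpa using this
  have j1 : IntervalIntegrable (fun y => |x - y| ^ q) volume 0 x := by
    refine i1.congr fun y hy => ?_
    rw [Set.uIoc_of_le hx.le] at hy
    simp only [abs_of_nonneg (sub_nonneg.2 hy.2)]
  have j2 : IntervalIntegrable (fun y => |x - y| ^ q) volume x r := by
    refine i2.congr fun y hy => ?_
    rw [Set.uIoc_of_le hxr] at hy
    simp only [abs_sub_comm x, abs_of_nonneg (sub_nonneg.2 hy.1.le)]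
  rw [lintegral_Ioo_ofReal_eq (hx.le.trans hxr) (j1.trans j2) fun y _ => by positivity,
    ← intervalIntegral.integral_add_adjacent_intervals j1 j2]
  have e1 : ∫ y in (0 : ℝ)..x, |x - y| ^ q = x ^ (q + 1) / (q + 1) := by
    rw [intervalIntegral.integral_congr (g := fun y => (x - y) ^ q) fun y hy => by
      rw [Set.uIcc_of_le hx.le] at hy
      simp only [abs_of_nonneg (sub_nonneg.2 hy.2)]]
    rw [intervalIntegral.integral_comp_sub_left (fun y => y ^ q) x, integral_rpow (Or.inl hq)]
    simp [Real.zero_rpow hq']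
  have e2 : ∫ y in x..r, |x - y| ^ q = (r - x) ^ (q + 1) / (q + 1) := by
    rw [intervalIntegral.integral_congr (g := fun y => (y - x) ^ q) fun y hy => by
      rw [Set.uIcc_of_le hxr] at hy
      simp only [abs_sub_comm x, abs_of_nonneg (sub_nonneg.2 hy.1)]]
    rw [intervalIntegral.integral_comp_sub_right (fun y => y ^ q) x, integral_rpow (Or.inl hq)]
    simp [Real.zero_rpow hq']
  rw [e1, e2, add_div]

theorem lintegral_rpow_add_rpow {p t r : ℝ} (hp : 0 < p) (ht : 0 ≤ t) (htr : t ≤ r) :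
    ∫⁻ x in Set.Ioo 0 t, ENNReal.ofReal ((x ^ p + (r - x) ^ p) / p) =
      ENNReal.ofReal ((t ^ (p + 1) + r ^ (p + 1) - (r - t) ^ (p + 1)) / (p * (p + 1))) := by
  have hp1 : p + 1 ≠ 0 := by linarith
  have i1 : IntervalIntegrable (fun x : ℝ => x ^ p) volume 0 t :=
    intervalIntegral.intervalIntegrable_rpow' (by linarith)
  have i2 : IntervalIntegrable (fun x => (r - x) ^ p) volume 0 t := by
    have := (intervalIntegral.intervalIntegrable_rpow' (a := r) (b := r - t) (r := p)
      (by linarith)).comp_sub_left r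
    simpa using this
  rw [lintegral_Ioo_ofReal_eq ht ((i1.add i2).div_const p) fun x hx => by
    have := hx.1.le
    have : 0 ≤ r - x := by linarith [hx.2]
    positivity]
  rw [intervalIntegral.integral_div, intervalIntegral.integral_add i1 i2,
    intervalIntegral.integral_comp_sub_left (fun y => y ^ p) r,
    integral_rpow (Or.inl (by linarith)), integral_rpow (Or.inl (by linarith)),
    Real.zero_rpow hp1, sub_zero, sub_zero]
  congr 1
  field_simp
  ring

/-- Writing both kernels as integrals and integrating out s first leaves H(2H - 1) ∫∫ |x - y|^{2H-2}
over (0,t) × (0,r). All integrands are nonnegative, so Tonelli applies without integrability checks,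
and finiteness of the L² norm of K_H follows. -/
theorem lintegral_KH_mul_KH_of_le (hH : 1 / 2 < H) (hH1 : H < 1) {t r : ℝ} (ht : 0 ≤ t)
    (htr : t ≤ r) :
    ∫⁻ s, ENNReal.ofReal (KH H t s * KH H r s) ∂halfLine = ENNReal.ofReal (RH H t r) := by
  set α := H - 1 / 2 with hα
  have hα0 : 0 < α := by linarith
  have hα1 : α < 1 / 2 := by linarith
  have hc := c_pos hH hH1
  have hb : 0 < beta α (1 - 2 * α) := beta_pos hα0 (by linarith)
  have hk : Measurable fun p : ℝ × ℝ => ENNReal.ofReal (mgKernel α p.1 p.2) :=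
    (measurable_mgKernel α).ennreal_ofReal
  have hk1 (s : ℝ) : Measurable fun x => ENNReal.ofReal (mgKernel α s x) :=
    hk.comp measurable_prodMk_left
  have hk2 (x : ℝ) : Measurable fun s => ENNReal.ofReal (mgKernel α s x) :=
    hk.comp measurable_prodMk_right
  calc ∫⁻ s, ENNReal.ofReal (KH H t s * KH H r s) ∂halfLine
      = ∫⁻ s, (ENNReal.ofReal (c H ^ 2) * ∫⁻ x in Set.Ioo 0 t, ∫⁻ y in Set.Ioo 0 r,
          ENNReal.ofReal (mgKernel α s x) * ENNReal.ofReal (mgKernel α s y)) ∂halfLine := by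
        refine lintegral_congr_ae (ae_pos_halfLine.mono fun s hs => ?_)
        simp only
        rw [ENNReal.ofReal_mul (KH_nonneg hH hH1 hs t), ofReal_KH hH hH1 hs, ofReal_KH hH hH1 hs,
          sq, ENNReal.ofReal_mul hc.le]
        simp only [lintegral_const_mul _ (hk1 s), lintegral_mul_const _ (hk1 s), ← hα]
        ring
    _ = ∫⁻ s, ENNReal.ofReal (c H ^ 2) * ∫⁻ x in Set.Ioo 0 t, ∫⁻ y in Set.Ioo 0 r,
          ENNReal.ofReal (mgKernel α s x) * ENNReal.ofReal (mgKernel α s y) := by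
        refine setLIntegral_eq_of_support_subset fun s hs => ?_
        by_contra h
        have h' : ¬ 0 < s := fun h0 => h (Set.mem_Ici.2 h0.le)
        simp [mgKernel, h'] at hs
    _ = ENNReal.ofReal (c H ^ 2) * ∫⁻ s, ∫⁻ x in Set.Ioo 0 t, ∫⁻ y in Set.Ioo 0 r,
          ENNReal.ofReal (mgKernel α s x) * ENNReal.ofReal (mgKernel α s y) :=
        lintegral_const_mul' _ _ (by finiteness)
    _ = ENNReal.ofReal (c H ^ 2) * ∫⁻ x in Set.Ioo 0 t, ∫⁻ y in Set.Ioo 0 r, ∫⁻ s,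
          ENNReal.ofReal (mgKernel α s x) * ENNReal.ofReal (mgKernel α s y) := by
        congr 1
        rw [lintegral_lintegral_swap]
        · refine lintegral_congr fun x => ?_
          rw [lintegral_lintegral_swap]
          refine Measurable.aemeasurable ?_
          exact ((hk2 x).comp measurable_fst).mul hk
        · refine Measurable.aemeasurable ?_
          refine Measurable.lintegral_prod_right' (f := fun p : (ℝ × ℝ) × ℝ =>
            ENNReal.ofReal (mgKernel α p.1.1 p.1.2) * ENNReal.ofReal (mgKernel α p.1.1 p.2)) ?_
          exact (hk.comp measurable_fst).mul
            (hk.comp ((measurable_fst.comp measurable_fst).prodMk measurable_snd))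
    _ = ENNReal.ofReal (c H ^ 2) * ∫⁻ x in Set.Ioo 0 t, ∫⁻ y in Set.Ioo 0 r,
          ENNReal.ofReal (beta α (1 - 2 * α)) * ENNReal.ofReal (|x - y| ^ (2 * α - 1)) := by
        congr 1
        refine setLIntegral_congr_fun measurableSet_Ioo fun x hx => ?_
        refine lintegral_congr_ae ?_
        filter_upwards [ae_restrict_mem measurableSet_Ioo, Measure.ae_ne (volume.restrict _) x]
          with y hy hxy
        exact lintegral_mgKernel_mul_mgKernel_abs hα0 hα1 hx.1 hy.1 hxy.symm
    _ = ENNReal.ofReal (c H ^ 2) * (ENNReal.ofReal (beta α (1 - 2 * α)) *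
          ∫⁻ x in Set.Ioo 0 t, ∫⁻ y in Set.Ioo 0 r, ENNReal.ofReal (|x - y| ^ (2 * α - 1))) := by
        simp only [lintegral_const_mul' _ _ ENNReal.ofReal_ne_top]
    _ = ENNReal.ofReal (c H ^ 2) * (ENNReal.ofReal (beta α (1 - 2 * α)) *
          ENNReal.ofReal ((t ^ (2 * α + 1) + r ^ (2 * α + 1) - (r - t) ^ (2 * α + 1)) /
            (2 * α * (2 * α + 1)))) := by
        rw [← lintegral_rpow_add_rpow (by linarith) ht htr]
        congr 2
        refine setLIntegral_congr_fun measurableSet_Ioo fun x hx => ?_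
        rw [lintegral_abs_sub_rpow (by linarith) hx.1 (hx.2.le.trans htr)]
        simp
    _ = ENNReal.ofReal (RH H t r) := by
        rw [← mul_assoc, ← ENNReal.ofReal_mul (by positivity), ← ENNReal.ofReal_mul (by positivity),
          c_sq_mul_beta hH hH1, RH, abs_sub_comm, abs_of_nonneg (sub_nonneg.2 htr),
          show 2 * α + 1 = 2 * H by rw [hα]; ring, show 2 * α = 2 * H - 1 by rw [hα]; ring]
        congr 1
        have h1 : 2 * H - 1 ≠ 0 := by linarith
        have h2 : H ≠ 0 := by linarith
        rw [mul_div_assoc', div_eq_iff (by positivity)]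
        ring

theorem RH_comm (t r : ℝ) : RH H t r = RH H r t := by
  rw [RH, RH, abs_sub_comm]; ring

theorem lintegral_KH_mul_KH (hH : 1 / 2 < H) (hH1 : H < 1) {t r : ℝ} (ht : 0 ≤ t) (hr : 0 ≤ r) :
    ∫⁻ s, ENNReal.ofReal (KH H t s * KH H r s) ∂halfLine = ENNReal.ofReal (RH H t r) := by
  rcases le_total t r with h | h
  · exact lintegral_KH_mul_KH_of_le hH hH1 ht h
  · rw [RH_comm, ← lintegral_KH_mul_KH_of_le hH hH1 hr h]
    simp only [mul_comm]

theorem memLp_KH (hH : 1 / 2 < H) (hH1 : H < 1) {t : ℝ} (ht : 0 ≤ t) :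
    MemLp (KH H t) 2 halfLine := by
  refine ⟨aestronglyMeasurable_KH t, ?_⟩
  rw [eLpNorm_lt_top_iff_lintegral_rpow_enorm_lt_top (by norm_num) (by norm_num)]
  have : ∫⁻ s, ‖KH H t s‖ₑ ^ ((2 : ℝ≥0∞).toReal) ∂halfLine =
      ∫⁻ s, ENNReal.ofReal (KH H t s * KH H t s) ∂halfLine := by
    refine lintegral_congr_ae (ae_pos_halfLine.mono fun s hs => ?_)
    have h0 := KH_nonneg hH hH1 hs t
    simp only
    rw [ENNReal.ofReal_mul h0, Real.enorm_of_nonneg h0, ENNReal.toReal_ofNat, ENNReal.rpow_two, sq]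
  rw [this, lintegral_KH_mul_KH hH hH1 ht ht]
  exact ENNReal.ofReal_lt_top

theorem RH_nonneg (hH : 1 / 2 < H) {t r : ℝ} (ht : 0 ≤ t) (hr : 0 ≤ r) : 0 ≤ RH H t r := by
  wlog h : t ≤ r generalizing t r
  · rw [RH_comm]; exact this hr ht (le_of_not_ge h)
  have h1 : |t - r| ^ (2 * H) ≤ r ^ (2 * H) := by
    refine Real.rpow_le_rpow (abs_nonneg _) ?_ (by linarith)
    rw [abs_sub_comm, abs_of_nonneg (sub_nonneg.2 h)]
    linarith
  have h2 : 0 ≤ t ^ (2 * H) := Real.rpow_nonneg ht _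
  unfold RH
  linarith

/-- The kernel `K_H` represents fractional Brownian motion. -/
theorem integral_KH_mul_KH (hH : 1 / 2 < H) (hH1 : H < 1) {t r : ℝ} (ht : 0 ≤ t) (hr : 0 ≤ r) :
    ∫ s, KH H t s * KH H r s ∂halfLine = RH H t r := by
  rw [integral_eq_lintegral_of_nonneg_ae, lintegral_KH_mul_KH hH hH1 ht hr,
    ENNReal.toReal_ofReal (RH_nonneg hH ht hr)]
  · exact ae_pos_halfLine.mono fun s hs =>
      mul_nonneg (KH_nonneg hH hH1 hs t) (KH_nonneg hH hH1 hs r)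
  · exact (aestronglyMeasurable_KH t).mul (aestronglyMeasurable_KH r)

end Kernel

/-! ### The kernel L and its adjoint associated operator -/

section KernelL

variable {H a b : ℝ}

theorem memLp_L (hH : 1 / 2 < H) (hH1 : H < 1) {t : ℝ} (ht : 0 ≤ t) :
    MemLp (L H a b t) 2 halfLine :=
  ((memLp_ind t).const_mul a).add ((memLp_KH hH hH1 ht).const_mul b)

theorem L_of_le {t s : ℝ} (h : t ≤ s) : L H a b t s = 0 := by
  rw [L, ind_of_le h, KH_of_le h, mul_zero, mul_zero, add_zero]

theorem integral_halfLine_eq_of_le {f : ℝ → ℝ} {m : ℝ} (hm : 0 ≤ m) (hf : ∀ v, m ≤ v → f v = 0) :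
    ∫ v, f v ∂halfLine = ∫ v in (0 : ℝ)..m, f v := by
  rw [intervalIntegral.integral_of_le hm, integral_Ici_eq_integral_Ioi]
  refine setIntegral_eq_of_subset_of_forall_sdiff_eq_zero measurableSet_Ioi
    Set.Ioc_subset_Ioi_self fun v hv => hf v ?_
  by_contra h
  exact hv.2 ⟨hv.1, (not_le.1 h).le⟩

theorem integral_ind_mul_KH {t s : ℝ} (ht : 0 ≤ t) (hs : 0 ≤ s) :
    ∫ v, ind t v * KH H s v ∂halfLine = ∫ v in (0 : ℝ)..min t s, KH H s v := by
  rw [integral_halfLine_eq_of_le (le_min ht hs)]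
  · refine intervalIntegral.integral_congr_ae ?_
    filter_upwards [Measure.ae_ne volume (min t s)] with v hv hv'
    rw [Set.uIoc_of_le (le_min ht hs)] at hv'
    rw [ind_of_lt hv'.1.le ((lt_of_le_of_ne hv'.2 hv).trans_le (min_le_left _ _)), one_mul]
  · intro v hv
    rcases min_le_iff.1 hv with h | h
    · rw [ind_of_le h, zero_mul]
    · rw [KH_of_le h, mul_zero]

theorem intervalIntegrable_KH (hH : 1 / 2 < H) (hH1 : H < 1) {t m : ℝ} (ht : 0 ≤ t) (hm : 0 ≤ m) :
    IntervalIntegrable (KH H t) volume 0 m := by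
  rw [intervalIntegrable_iff_integrableOn_Ioc_of_le hm]
  have h : MemLp (KH H t) 2 (volume.restrict (Set.Ioc 0 m)) :=
    (memLp_KH hH hH1 ht).mono_measure
      (Measure.restrict_mono (fun x hx => hx.1.le) le_rfl)
  exact h.integrable (by norm_num)

/-- The kernel `L` represents the completely correlated mixed fractional Brownian motion. -/
theorem integral_L_mul_L (hH : 1 / 2 < H) (hH1 : H < 1) {t s : ℝ} (ht : 0 ≤ t) (hs : 0 ≤ s) :
    ∫ v, L H a b t v * L H a b s v ∂halfLine = R H a b t s := by
  have hKt := memLp_KH hH hH1 ht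
  have hKs := memLp_KH hH hH1 hs
  have hit : MemLp (ind t) 2 halfLine := memLp_ind t
  have his : MemLp (ind s) 2 halfLine := memLp_ind s
  have e (v : ℝ) : L H a b t v * L H a b s v = a ^ 2 * (ind t v * ind s v) +
      a * b * (ind s v * KH H t v + ind t v * KH H s v) + b ^ 2 * (KH H t v * KH H s v) := by
    rw [L, L]; ring
  simp only [e]
  have j1 : Integrable (fun v => ind s v * KH H t v) halfLine := his.integrable_mul hKt
  have j2 : Integrable (fun v => ind t v * KH H s v) halfLine := hit.integrable_mul hKs
  have i1 : Integrable (fun v => a ^ 2 * (ind t v * ind s v)) halfLine :=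
    (hit.integrable_mul his).const_mul (a ^ 2)
  have i2 : Integrable (fun v => a * b * (ind s v * KH H t v + ind t v * KH H s v)) halfLine :=
    (j1.add j2).const_mul (a * b)
  have i3 : Integrable (fun v => b ^ 2 * (KH H t v * KH H s v)) halfLine :=
    (hKt.integrable_mul hKs).const_mul (b ^ 2)
  have i12 : Integrable (fun v => a ^ 2 * (ind t v * ind s v) +
    a * b * (ind s v * KH H t v + ind t v * KH H s v)) halfLine := i1.add i2
  have hii : ∫ v, ind t v * ind s v ∂halfLine = min t s := by
    lift t to ℝ≥0 using ht
    lift s to ℝ≥0 using hs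
    exact_mod_cast integral_ind_mul_ind t s
  rw [integral_add i12 i3, integral_add i1 i2, integral_const_mul, integral_const_mul,
    integral_const_mul, integral_add j1 j2]
  rw [R, hii, integral_KH_mul_KH hH hH1 ht hs, integral_ind_mul_KH hs ht,
    integral_ind_mul_KH ht hs, min_comm s t,
    intervalIntegral.integral_add (intervalIntegrable_KH hH hH1 ht (le_min ht hs))
      (intervalIntegrable_KH hH hH1 hs (le_min ht hs))]

/-- The full inner product over the half-line is R(t,s); removing the part over [0,u] leaves the
conditional covariance. -/
theorem integral_indicator_L_mul_L (hH : 1 / 2 < H) (hH1 : H < 1) {t s : ℝ} (ht : 0 ≤ t)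
    (hs : 0 ≤ s) (u : ℝ≥0) :
    ∫ v, (Set.Ici (u : ℝ)).indicator (L H a b t) v * (Set.Ici (u : ℝ)).indicator (L H a b s) v
      ∂halfLine = condR H a b u t s := by
  have hint := (memLp_L (a := a) (b := b) hH hH1 ht).integrable_mul
    (memLp_L (a := a) (b := b) hH hH1 hs)
  have e (v : ℝ) : (Set.Ici (u : ℝ)).indicator (L H a b t) v *
      (Set.Ici (u : ℝ)).indicator (L H a b s) v =
      (Set.Ici (u : ℝ)).indicator (fun v => L H a b t v * L H a b s v) v := by
    by_cases h : v ∈ Set.Ici (u : ℝ) <;> simp [h]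
  simp only [e]
  have hsub : Set.Ici (u : ℝ) ⊆ Set.Ici 0 := Set.Ici_subset_Ici.2 u.coe_nonneg
  rw [condR, ← integral_L_mul_L hH hH1 ht hs, intervalIntegral.integral_of_le u.coe_nonneg,
    integral_indicator measurableSet_Ici, Measure.restrict_restrict measurableSet_Ici,
    Set.inter_eq_left.2 hsub, eq_sub_iff_add_eq, integral_Ici_eq_integral_Ioi,
    integral_Ici_eq_integral_Ioi, ← Set.Ioc_union_Ioi_eq_Ioi u.coe_nonneg, add_comm]
  have hint' : IntegrableOn (fun v => L H a b t v * L H a b s v) (Set.Ici 0) := hint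
  refine (setIntegral_union ?_ measurableSet_Ioi ?_ ?_).symm
  · exact Set.Ioc_disjoint_Ioi le_rfl
  · exact hint'.mono_set fun x hx => hx.1.le
  · exact hint'.mono_set fun x hx => u.coe_nonneg.trans hx.le

theorem integral_mgKernel_mul_ind {s t : ℝ} {u : ℝ≥0} (htu : t ≤ u) (α : ℝ) :
    ∫ v, mgKernel α s v * ind t v ∂lebesgueOn u = ∫ v in Set.Ioo 0 t, mgKernel α s v := by
  have e (v : ℝ) : mgKernel α s v * ind t v = (Set.Ioo 0 t).indicator (mgKernel α s) v := by
    simp only [ind, Set.indicator, Set.mem_Ico, Set.mem_Ioo, Pi.one_apply]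
    rcases lt_trichotomy 0 v with h | h | h
    · simp [h, h.le]
    · have : mgKernel α s v = 0 := by
        rw [mgKernel, if_neg]
        rintro ⟨h1, h2⟩
        linarith
      simp [this]
    · simp [h.not_ge, h.not_gt]
  have hsub : Set.Ioo 0 t ⊆ Set.Icc 0 (u : ℝ) := fun v hv => ⟨hv.1.le, hv.2.le.trans htu⟩
  simp only [e]
  rw [integral_indicator measurableSet_Ioo, Measure.restrict_restrict measurableSet_Ioo,
    Set.inter_eq_left.2 hsub]

/-- The adjoint associated operator of `L` exists, is unique, and is invertible. -/
theorem exists_adjointAssociated_equiv (hH : 1 / 2 < H) (hH1 : H < 1) (ha : a ≠ 0) (u : ℝ≥0) :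
    ∃ Lstar : L2 u ≃L[ℝ] L2 u,
      ∀ A : L2 u →L[ℝ] L2 u, IsAdjointAssociated (L H a b) u A ↔ A = Lstar := by
  -- The coefficient `b * c H` absorbs the normalization of K_H, which `mgKernel` omits.
  obtain ⟨Lstar, hL⟩ := exists_equiv_add_mgKernel (u := u) (α := H - 1 / 2) (b := b * c H)
    (by linarith) (by linarith) ha
  have hadj : IsAdjointAssociated (L H a b) u (Lstar : L2 u →L[ℝ] L2 u) := by
    intro t ht htu f hf
    refine (hL f).trans ?_
    filter_upwards [hf, ae_pos_lebesgueOn] with s hs hs0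
    have : ∫ v, mgKernel (H - 1 / 2) s v * f v ∂lebesgueOn u =
        ∫ v in Set.Ioo 0 t, mgKernel (H - 1 / 2) s v := by
      rw [← integral_mgKernel_mul_ind htu]
      exact integral_congr_ae (hf.mono fun v hv => by simp only [hv])
    rw [this, hs, L, KH_eq_integral_mgKernel hs0]
    ring
  refine ⟨Lstar, fun A => ⟨fun hA => ?_, fun h => h ▸ hadj⟩⟩
  refine ContinuousLinearMap.ext_on
    (Submodule.dense_iff_topologicalClosure_eq_top.2 (span_ind_lebesgueOn u)) ?_
  rintro _ ⟨t, ht, rfl⟩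
  have hc := (memLp_ind (S := Set.Icc (0 : ℝ) u) t).coeFn_toLp
  exact Lp.ext ((hA t t.coe_nonneg (NNReal.coe_le_coe.2 ht) _ hc).trans
    (hadj t t.coe_nonneg (NNReal.coe_le_coe.2 ht) _ hc).symm)

end KernelL

/-! ### Wiener integrals as images under bounded operators -/

section WienerIntegral

variable {Ω : Type*} [mΩ : MeasurableSpace Ω] {P : Measure Ω} {u : ℝ≥0}

/-- Extension by zero from `[0,u]` to the half-line. -/
theorem exists_extendZero (u : ℝ≥0) :
    ∃ T : L2 u →L[ℝ] Lp ℝ 2 halfLine,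
      ∀ f : L2 u, T f =ᵐ[halfLine] (Set.Icc (0 : ℝ) u).indicator f := by
  have hr : halfLine.restrict (Set.Icc (0 : ℝ) u) = lebesgueOn u := by
    rw [Measure.restrict_restrict measurableSet_Icc, Set.inter_eq_left.2 Set.Icc_subset_Ici_self]
  have hmem (f : L2 u) : MemLp ((Set.Icc (0 : ℝ) u).indicator f) 2 halfLine := by
    rw [memLp_indicator_iff_restrict measurableSet_Icc, hr]
    exact Lp.memLp f
  have hae {p : ℝ → Prop} (h : ∀ᵐ x ∂lebesgueOn u, p x) :
      ∀ᵐ x ∂halfLine, x ∈ Set.Icc (0 : ℝ) u → p x := by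
    rwa [← ae_restrict_iff' measurableSet_Icc, hr]
  let T : L2 u →ₗ[ℝ] Lp ℝ 2 halfLine :=
    { toFun := fun f => (hmem f).toLp
      map_add' := fun f g => by
        rw [← MemLp.toLp_add, MemLp.toLp_eq_toLp_iff]
        filter_upwards [hae (Lp.coeFn_add f g)] with x hx
        by_cases h : x ∈ Set.Icc (0 : ℝ) u
        · rw [Pi.add_apply, Set.indicator_of_mem h, Set.indicator_of_mem h, Set.indicator_of_mem h,
            hx h, Pi.add_apply]
        · simp [h]
      map_smul' := fun c f => by
        rw [RingHom.id_apply, ← MemLp.toLp_const_smul, MemLp.toLp_eq_toLp_iff]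
        filter_upwards [hae (Lp.coeFn_smul c f)] with x hx
        by_cases h : x ∈ Set.Icc (0 : ℝ) u
        · simp [h, hx h]
        · simp [h] }
  refine ⟨T.mkContinuous 1 fun f => ?_, fun f => (hmem f).coeFn_toLp⟩
  change ‖(hmem f).toLp‖ ≤ _
  rw [Lp.norm_toLp, eLpNorm_indicator_eq_eLpNorm_restrict measurableSet_Icc, hr, one_mul, Lp.norm_def]

variable {Z : ℝ≥0 → Ω → ℝ} {J : L2 u →L[ℝ] Lp ℝ 2 P}

theorem coeFn_linearCombination_ind (φ : ℝ≥0 →₀ ℝ) {S : Set ℝ} :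
    Finsupp.linearCombination ℝ (fun t : ℝ≥0 => (memLp_ind (S := S) t).toLp) φ
      =ᵐ[volume.restrict S] stepFun φ :=
  coeFn_linearCombination_toLp (fun t : ℝ≥0 => memLp_ind (S := S) t) φ

theorem coeFn_map_linearCombination_ind
    (hJ : ∀ t : ℝ≥0, t ≤ u → J ((memLp_ind (t : ℝ)).toLp) =ᵐ[P] Z t) {φ : ℝ≥0 →₀ ℝ}
    (hφ : ∀ t ∈ φ.support, t ≤ u) :
    J (Finsupp.linearCombination ℝ (fun t : ℝ≥0 => (memLp_ind (t : ℝ)).toLp) φ)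
      =ᵐ[P] stepIntegral Z φ := by
  rw [Finsupp.linearCombination_apply, Finsupp.sum, map_sum]
  refine (Lp.coeFn_finsetSum _ _).trans ?_
  have : ∀ᵐ ω ∂P, ∀ t : φ.support,
      J (φ t • (memLp_ind (S := Set.Icc (0 : ℝ) u) ((t : ℝ≥0) : ℝ)).toLp) ω = φ t * Z t ω := by
    refine ae_all_iff.2 fun t => ?_
    rw [map_smul]
    filter_upwards [Lp.coeFn_smul (φ t) (J (memLp_ind ((t : ℝ≥0) : ℝ)).toLp), hJ t (hφ t t.2)]
      with ω h1 h2
    rw [h1, Pi.smul_apply, h2, smul_eq_mul]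
  filter_upwards [this] with ω hω
  rw [Finset.sum_apply, stepIntegral, Finsupp.sum]
  exact Finset.sum_congr rfl fun t ht => hω ⟨t, ht⟩

theorem tendsto_Lp_of_tendsto_eLpNorm {α : Type*} {mα : MeasurableSpace α} {μ : Measure α}
    {f : Lp ℝ 2 μ} {F : ℕ → Lp ℝ 2 μ} {g : α → ℝ} {G : ℕ → α → ℝ} (hf : f =ᵐ[μ] g)
    (hF : ∀ n, F n =ᵐ[μ] G n)
    (h : Tendsto (fun n => eLpNorm (fun x => g x - G n x) 2 μ) atTop (𝓝 0)) :
    Tendsto F atTop (𝓝 f) := by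
  rw [Lp.tendsto_Lp_iff_tendsto_eLpNorm']
  refine h.congr fun n => ?_
  rw [eLpNorm_sub_comm]
  refine eLpNorm_congr_ae ?_
  filter_upwards [hf, hF n] with x h1 h2
  rw [Pi.sub_apply, h1, h2]

/-- A Wiener integral of `f` against `Z` is the image of `f` under the bounded operator that maps
the indicator functions `1_t` to `Z_t`. -/
theorem IsWienerIntegral.ae_eq
    (hJ : ∀ t : ℝ≥0, t ≤ u → J ((memLp_ind (t : ℝ)).toLp) =ᵐ[P] Z t) {f : ℝ → ℝ} {Y : Ω → ℝ}
    (hY : IsWienerIntegral Z P u f Y) {g : L2 u} (hg : g =ᵐ[lebesgueOn u] f) : Y =ᵐ[P] J g := by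
  obtain ⟨-, hYm, φ, hφ, h1, h2⟩ := hY
  have t1 := tendsto_Lp_of_tendsto_eLpNorm hg (fun n => coeFn_linearCombination_ind (φ n)) h1
  have t2 := tendsto_Lp_of_tendsto_eLpNorm hYm.coeFn_toLp
    (fun n => coeFn_map_linearCombination_ind hJ (hφ n)) h2
  have := tendsto_nhds_unique ((J.continuous.tendsto g).comp t1) t2
  rw [this]
  exact hYm.coeFn_toLp.symm

theorem exists_tendsto_linearCombination_ind (g : L2 u) :
    ∃ φ : ℕ → (ℝ≥0 →₀ ℝ), (∀ n, ∀ t ∈ (φ n).support, t ≤ u) ∧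
      Tendsto (fun n => Finsupp.linearCombination ℝ
        (fun t : ℝ≥0 => (memLp_ind (S := Set.Icc (0 : ℝ) u) (t : ℝ)).toLp) (φ n)) atTop (𝓝 g) := by
  have hd := (Submodule.dense_iff_topologicalClosure_eq_top.2 (span_ind_lebesgueOn u)) g
  obtain ⟨x, hx, hxg⟩ := mem_closure_iff_seq_limit.1 hd
  have (n : ℕ) := (Finsupp.mem_span_image_iff_linearCombination ℝ).1 (hx n)
  choose φ hφ hφx using this
  exact ⟨φ, fun n t ht => hφ n ht, by simpa only [hφx] using hxg⟩

/-- Step functions approximating `g` in L² have elementary integrals converging to `J g`, by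
continuity of `J`. -/
theorem isWienerIntegral_map
    (hJ : ∀ t : ℝ≥0, t ≤ u → J ((memLp_ind (t : ℝ)).toLp) =ᵐ[P] Z t) (g : L2 u) :
    IsWienerIntegral Z P u g (J g) := by
  obtain ⟨φ, hφ, h⟩ := exists_tendsto_linearCombination_ind g
  refine ⟨Lp.memLp g, Lp.memLp (J g), φ, hφ, ?_, ?_⟩
  · refine ((Lp.tendsto_Lp_iff_tendsto_eLpNorm' _ _).1 h).congr fun n => ?_
    rw [eLpNorm_sub_comm]
    refine eLpNorm_congr_ae ?_
    filter_upwards [coeFn_linearCombination_ind (S := Set.Icc (0 : ℝ) u) (φ n)] with x hx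
    rw [Pi.sub_apply, hx]
  · refine ((Lp.tendsto_Lp_iff_tendsto_eLpNorm' _ _).1
      ((J.continuous.tendsto g).comp h)).congr fun n => ?_
    rw [eLpNorm_sub_comm]
    refine eLpNorm_congr_ae ?_
    filter_upwards [coeFn_map_linearCombination_ind hJ (hφ n)] with x hx
    rw [Pi.sub_apply, Function.comp_apply, hx]

theorem sigmaUpTo_le (hZ : ∀ t, Measurable (Z t)) (u : ℝ≥0) : sigmaUpTo Z u ≤ mΩ :=
  iSup₂_le fun t _ => (hZ t).comap_le

theorem stronglyMeasurable_stepIntegral {φ : ℝ≥0 →₀ ℝ} (hZ : ∀ t ∈ φ.support, Measurable (Z t)) :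
    StronglyMeasurable (stepIntegral Z φ) :=
  (Finset.measurable_fun_sum _ fun t ht => (hZ t ht).const_mul (φ t)).stronglyMeasurable

theorem measurable_sigmaUpTo {Ω : Type*} (Z : ℝ≥0 → Ω → ℝ) {u : ℝ≥0} {t : ℝ≥0} (ht : t ≤ u) :
    Measurable[sigmaUpTo Z u] (Z t) :=
  Measurable.mono (comap_measurable (Z t))
    (le_iSup₂ (f := fun s (_ : s ≤ u) => MeasurableSpace.comap (Z s) inferInstance) t ht) le_rfl

/-- Elementary integrals with times up to u are measurable with respect to F_u, and this property,
up to null sets, is closed under L² limits. -/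
theorem aestronglyMeasurable_map
    (hJ : ∀ t : ℝ≥0, t ≤ u → J ((memLp_ind (t : ℝ)).toLp) =ᵐ[P] Z t) (hZ : ∀ t, Measurable (Z t))
    (g : L2 u) : AEStronglyMeasurable[sigmaUpTo Z u] (J g) P := by
  obtain ⟨φ, hφ, h⟩ := exists_tendsto_linearCombination_ind g
  refine (isClosed_aestronglyMeasurable (sigmaUpTo_le hZ u)).mem_of_tendsto
    ((J.continuous.tendsto g).comp h) (Eventually.of_forall fun n => ?_)
  exact ⟨stepIntegral Z (φ n), @stronglyMeasurable_stepIntegral Ω (sigmaUpTo Z u) Z (φ n)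
    fun t ht => measurable_sigmaUpTo Z (hφ n t ht), coeFn_map_linearCombination_ind hJ (hφ n)⟩

theorem sigmaUpTo_eq_comap {Ω : Type*} (Z : ℝ≥0 → Ω → ℝ) (u : ℝ≥0) :
    sigmaUpTo Z u =
      MeasurableSpace.comap (fun ω (s : {s : ℝ≥0 // s ≤ u}) => Z s ω) inferInstance := by
  simp only [MeasurableSpace.pi, MeasurableSpace.comap_iSup, MeasurableSpace.comap_comp,
    Function.comp_def, sigmaUpTo, iSup_subtype]

end WienerIntegral

/-! ### Translated laws as kernels -/

section ConditionalLaw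

theorem exists_kernel_translate {Ω T : Type*} [MeasurableSpace Ω] (ν : Measure (T → ℝ)) [SFinite ν]
    {m : Ω → T → ℝ} (hm : ∀ t, Measurable fun ω => m ω t) :
    ∃ κ : Kernel Ω (T → ℝ), ∀ ω, κ ω = ν.map fun z t => m ω t + z t := by
  have hz (ω : Ω) : Measurable fun (z : T → ℝ) t => m ω t + z t := by fun_prop
  refine ⟨⟨fun ω => ν.map fun z t => m ω t + z t, ?_⟩, fun ω => rfl⟩
  refine Measure.measurable_of_measurable_coe _ fun B hB => ?_
  simp only [Measure.map_apply (hz _) hB]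
  have hp : Measurable fun (p : Ω × (T → ℝ)) t => m p.1 t + p.2 t :=
    measurable_pi_lambda _ fun t => ((hm t).comp measurable_fst).add (by fun_prop)
  exact measurable_measure_prodMk_left (hp hB)

/-- Independence makes the joint law of (p, Z) a product, so by Tonelli p may be frozen while Z is
integrated out. -/
theorem setLIntegral_map_translate {Ω Ω' T : Type*} [MeasurableSpace Ω] [MeasurableSpace Ω']
    {P : Measure Ω} [IsProbabilityMeasure P] {p : Ω → Ω'} {Z : Ω → T → ℝ} (hp : Measurable p)
    (hZ : Measurable Z) (hind : IndepFun p Z P) {m : Ω' → T → ℝ}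
    (hm : ∀ t, Measurable fun ω => m ω t) {A : Set Ω'} (hA : MeasurableSet A) {B : Set (T → ℝ)}
    (hB : MeasurableSet B) :
    ∫⁻ ω in p ⁻¹' A, ((P.map Z).map fun z t => m (p ω) t + z t) B ∂P =
      P (p ⁻¹' A ∩ {ω | (fun t => m (p ω) t + Z ω t) ∈ B}) := by
  have hz (ω : Ω') : Measurable fun (z : T → ℝ) t => m ω t + z t := by fun_prop
  have hmz : Measurable fun (q : Ω' × (T → ℝ)) t => m q.1 t + q.2 t :=
    measurable_pi_lambda _ fun t => ((hm t).comp measurable_fst).add (by fun_prop)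
  have hD : MeasurableSet ((A ×ˢ Set.univ) ∩ {q : Ω' × (T → ℝ) | (fun t => m q.1 t + q.2 t) ∈ B}) :=
    (hA.prod MeasurableSet.univ).inter (hmz hB)
  have h1 : P (p ⁻¹' A ∩ {ω | (fun t => m (p ω) t + Z ω t) ∈ B}) =
      P.map (fun ω => (p ω, Z ω))
        ((A ×ˢ Set.univ) ∩ {q : Ω' × (T → ℝ) | (fun t => m q.1 t + q.2 t) ∈ B}) := by
    rw [Measure.map_apply (hp.prodMk hZ) hD]
    congr 1
    ext ω
    simp
  have hmeas : Measurable fun ω => (P.map Z) ((fun z t => m ω t + z t) ⁻¹' B) :=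
    measurable_measure_prodMk_left (hmz hB)
  rw [h1, (indepFun_iff_map_prod_eq_prod_map_map hp.aemeasurable hZ.aemeasurable).1 hind,
    Measure.prod_apply hD, lintegral_map (measurable_measure_prodMk_left hD) hp,
    ← lintegral_indicator (hp hA)]
  refine lintegral_congr fun ω => ?_
  by_cases hω : ω ∈ p ⁻¹' A
  · rw [Set.indicator_of_mem hω, Measure.map_apply (hz _) hB]
    congr 1
    ext z
    simp only [Set.mem_preimage] at hω
    simp [hω]
  · rw [Set.indicator_of_notMem hω]
    simp only [Set.mem_preimage] at hω
    simp [Set.preimage_inter, hω]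

theorem isGaussianProcess_const_add {Ω T : Type*} [MeasurableSpace Ω] {P : Measure Ω}
    {Z : T → Ω → ℝ} (hZ : IsGaussianProcess Z P) (m : T → ℝ) :
    IsGaussianProcess (fun t ω => m t + Z t ω) P := by
  refine ⟨fun J => ⟨?_⟩⟩
  have h1 := (hZ.hasGaussianLaw J).isGaussian_map
  have h2 : P.map (fun ω => J.restrict fun t => m t + Z t ω) =
      (P.map fun ω => J.restrict (Z · ω)).map fun x => (fun j : J => m j) + x := by
    rw [AEMeasurable.map_map_of_aemeasurable (by fun_prop) (hZ.hasGaussianLaw J).aemeasurable]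
    rfl
  rw [h2]
  infer_instance

theorem isGaussianProcess_eval_map {Ω T : Type*} [MeasurableSpace Ω] {P : Measure Ω}
    {Y : T → Ω → ℝ} (hY : IsGaussianProcess Y P) (hm : ∀ t, Measurable (Y t)) :
    IsGaussianProcess (fun t (x : T → ℝ) => x t) (P.map fun ω t => Y t ω) := by
  refine ⟨fun J => ⟨?_⟩⟩
  have h1 := (hY.hasGaussianLaw J).isGaussian_map
  rw [Measure.map_map (by fun_prop) (by fun_prop)]
  exact h1

end ConditionalLaw

/-! ### Representation of X by the Wiener isometry -/

section Representation

variable {Ω : Type*} [mΩ : MeasurableSpace Ω] {P : Measure Ω} {u : ℝ≥0} {H a b : ℝ}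

theorem extendZero_eq_toLp {T : L2 u →L[ℝ] Lp ℝ 2 halfLine}
    (hT : ∀ f : L2 u, T f =ᵐ[halfLine] (Set.Icc (0 : ℝ) u).indicator f) {f : ℝ → ℝ}
    (hf : MemLp f 2 halfLine) (hf0 : ∀ s, (u : ℝ) ≤ s → f s = 0) {g : L2 u}
    (hg : g =ᵐ[lebesgueOn u] f) : T g = hf.toLp := by
  refine Lp.ext ((hT g).trans (EventuallyEq.trans ?_ hf.coeFn_toLp.symm))
  have hg' : ∀ᵐ x ∂halfLine, x ∈ Set.Icc (0 : ℝ) u → g x = f x := by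
    rwa [← ae_restrict_iff' measurableSet_Icc, Measure.restrict_restrict measurableSet_Icc,
      Set.inter_eq_left.2 Set.Icc_subset_Ici_self]
  filter_upwards [hg', ae_pos_halfLine] with x h1 h2
  by_cases hx : x ≤ u
  · have hx' : x ∈ Set.Icc (0 : ℝ) u := ⟨h2.le, hx⟩
    rw [Set.indicator_of_mem hx', h1 hx']
  · rw [Set.indicator_of_notMem (fun h => hx h.2), hf0 x (not_le.1 hx).le]

theorem exists_isometry_of_isCcmfBm [IsProbabilityMeasure P] {X : ℝ≥0 → Ω → ℝ} (hH : 1 / 2 < H)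
    (hH1 : H < 1) (hX : IsCcmfBm H a b X P) :
    ∃ I : Lp ℝ 2 halfLine →ₗᵢ[ℝ] Lp ℝ 2 P,
      (∀ t : ℝ≥0, X t =ᵐ[P] I (memLp_L (a := a) (b := b) hH hH1 t.coe_nonneg).toLp) ∧
      (∀ f, ∫ ω, I f ω ∂P = 0) ∧ IsGaussianProcess (fun f => ⇑(I f)) P := by
  obtain ⟨W, BH, hW, hBH, hX⟩ := hX
  obtain ⟨I, hI, hI0, hG⟩ := exists_wienerIsometry hW
  refine ⟨I, fun t => ?_, hI0, hG⟩
  have hK := memLp_KH hH hH1 t.coe_nonneg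
  -- `BH t` is given only as a limit of step integrals. Extension by zero followed by `I` maps 1_s
  -- to W_s for s ≤ t, which fixes the limit; K_H(t,·) vanishes beyond t, so its extension by zero
  -- is itself.
  have hBHt : BH t =ᵐ[P] I hK.toLp := by
    obtain ⟨T, hT⟩ := exists_extendZero t
    have hJ (s : ℝ≥0) (hs : s ≤ t) :
        (I.toContinuousLinearMap ∘L T) ((memLp_ind (s : ℝ)).toLp) =ᵐ[P] W s := by
      refine EventuallyEq.trans ?_ (hI s)
      rw [ContinuousLinearMap.comp_apply, extendZero_eq_toLp hT (memLp_ind (S := Set.Ici 0) (s : ℝ))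
        (fun v hv => ind_of_le ((NNReal.coe_le_coe.2 hs).trans hv)) (memLp_ind (s : ℝ)).coeFn_toLp]
      rfl
    refine ((hBH t).ae_eq hJ (hBH t).1.coeFn_toLp).trans ?_
    rw [ContinuousLinearMap.comp_apply, extendZero_eq_toLp hT hK (fun v hv => KH_of_le hv)
      (hBH t).1.coeFn_toLp]
    rfl
  have hL : (memLp_L (a := a) (b := b) hH hH1 t.coe_nonneg).toLp =
      a • (memLp_ind (S := Set.Ici 0) (t : ℝ)).toLp + b • hK.toLp := by
    rw [← MemLp.toLp_const_smul, ← MemLp.toLp_const_smul, ← MemLp.toLp_add]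
    rfl
  rw [hL, map_add, map_smul, map_smul]
  filter_upwards [hX t, hI t, hBHt, Lp.coeFn_add (a • I (memLp_ind (S := Set.Ici 0) (t : ℝ)).toLp)
    (b • I hK.toLp), Lp.coeFn_smul a (I (memLp_ind (S := Set.Ici 0) (t : ℝ)).toLp),
    Lp.coeFn_smul b (I hK.toLp)] with ω h1 h2 h3 h4 h5 h6
  rw [h1, h4, Pi.add_apply, h5, h6, Pi.smul_apply, Pi.smul_apply, h2, ← h3, smul_eq_mul, smul_eq_mul]

end Representation

/-! ### Orthogonality and independence -/

section GaussianIsometry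

variable {Ω E : Type*} [MeasurableSpace Ω] {P : Measure Ω} [NormedAddCommGroup E]
  [InnerProductSpace ℝ E] {I : E →ₗᵢ[ℝ] Lp ℝ 2 P}

theorem integral_mul_eq_inner {f g : E} {Y Z : Ω → ℝ} (hY : Y =ᵐ[P] I f) (hZ : Z =ᵐ[P] I g) :
    ∫ ω, Y ω * Z ω ∂P = inner ℝ f g := by
  rw [← I.inner_map_map, L2.inner_def]
  refine integral_congr_ae ?_
  filter_upwards [hY, hZ] with ω h1 h2
  simp [h1, h2, mul_comm]

theorem covariance_eq_inner [IsProbabilityMeasure P] (hI0 : ∀ f, ∫ ω, I f ω ∂P = 0) {f g : E}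
    {Y Z : Ω → ℝ} (hY : Y =ᵐ[P] I f) (hZ : Z =ᵐ[P] I g) : cov[Y, Z; P] = inner ℝ f g := by
  rw [covariance_eq_sub ((Lp.memLp (I f)).ae_eq hY.symm) ((Lp.memLp (I g)).ae_eq hZ.symm),
    integral_congr_ae hY, hI0, zero_mul, sub_zero]
  exact integral_mul_eq_inner hY hZ

/-- Both families belong to one Gaussian process, the image of `I`, and covariances there are inner
products; for jointly Gaussian families zero covariance means independence. -/
theorem indep_of_inner_eq_zero [IsProbabilityMeasure P] (hI0 : ∀ f, ∫ ω, I f ω ∂P = 0)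
    (hG : IsGaussianProcess (fun f => ⇑(I f)) P) {X : ℝ≥0 → Ω → ℝ} {g : ℝ≥0 → E}
    (hX : ∀ t, X t =ᵐ[P] I (g t)) {u : ℝ≥0} {T : Type*} {Z : T → Ω → ℝ} {h : T → E}
    (hZ : ∀ t, Z t =ᵐ[P] I (h t)) (hgh : ∀ t, ∀ s ≤ u, inner ℝ (h t) (g s) = 0) :
    Indep (MeasurableSpace.comap (fun ω t => Z t ω) inferInstance) (sigmaUpTo X u) P := by
  rw [sigmaUpTo_eq_comap, ← IndepFun_iff_Indep]
  refine IsGaussianProcess.indepFun_of_covariance_eq_zero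
    (Y := fun s : {s : ℝ≥0 // s ≤ u} => X s) ?_ (fun t => ?_) (fun s => ?_) fun t s => ?_
  · refine (hG.comp_right (Sum.elim h fun s : {s : ℝ≥0 // s ≤ u} => g s)).congr ?_
    rintro (t | s)
    · exact (hZ t).symm
    · exact (hX s).symm
  · exact (Lp.aestronglyMeasurable (I (h t))).aemeasurable.congr (hZ t).symm
  · exact (Lp.aestronglyMeasurable (I (g s))).aemeasurable.congr (hX s).symm
  · rw [covariance_eq_inner hI0 (hZ t) (hX s), hgh t s s.2]

end GaussianIsometry

/-! ### Regular conditional laws by translation -/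

section RegularCondLaw

/-- If `X = m + Z` with `m` measurable with respect to `F` and `Z` independent of `F`, then the
translates of the law of `Z` by `m` are a regular conditional law of `X` given `F`. -/
theorem isRegularCondLaw_translate {Ω T : Type*} {F : MeasurableSpace Ω} [mΩ : MeasurableSpace Ω]
    (hF : F ≤ mΩ) {P : Measure Ω} [IsProbabilityMeasure P] {Z : Ω → T → ℝ} (hZ : Measurable Z)
    (hind : Indep (MeasurableSpace.comap Z inferInstance) F P) {m : Ω → T → ℝ}
    (hm : ∀ t, Measurable[F] fun ω => m ω t) {κ : @Kernel Ω (T → ℝ) F _}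
    (hκ : ∀ ω, κ ω = (P.map Z).map fun z t => m ω t + z t) :
    IsRegularCondLaw F (fun ω t => m ω t + Z ω t) κ P := by
  have hmΩ (t : T) : Measurable fun ω => m ω t := (hm t).mono hF le_rfl
  have hX : Measurable fun ω t => m ω t + Z ω t :=
    measurable_pi_lambda _ fun t => (hmΩ t).add ((measurable_pi_apply t).comp hZ)
  have := Measure.isProbabilityMeasure_map (μ := P) hZ.aemeasurable
  have hprob (ω : Ω) : IsProbabilityMeasure (κ ω) := by
    rw [hκ]
    exact Measure.isProbabilityMeasure_map
      (measurable_pi_lambda _ fun t => (measurable_pi_apply t).const_add (m ω t)).aemeasurable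
  intro B hB
  have hκm : Measurable[F] fun ω => κ ω B := Kernel.measurable_coe κ hB
  have hκr : StronglyMeasurable[F] fun ω => (κ ω).real B := hκm.ennreal_toReal.stronglyMeasurable
  have hbound (ω : Ω) : ‖(κ ω).real B‖ ≤ 1 := by
    rw [Real.norm_of_nonneg measureReal_nonneg]
    exact measureReal_le_one
  have hint : Integrable (fun ω => (κ ω).real B) P :=
    (integrable_const (1 : ℝ)).mono' (hκr.mono hF).aestronglyMeasurable
      (Eventually.of_forall hbound)
  refine ae_eq_condExp_of_forall_setIntegral_eq hF ?_ (fun A _ _ => hint.integrableOn)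
    (fun A hA _ => ?_) hκr.aestronglyMeasurable
  · exact (integrable_const (1 : ℝ)).indicator (hX hB)
  -- The identity, as a map into Ω with the smaller σ-algebra `F`, generates `F`; independence of
  -- `Z` from `F` becomes independence from this map.
  · have hid : @Measurable Ω Ω mΩ F id := fun s hs => hF s hs
    have hindf : @IndepFun Ω Ω (T → ℝ) mΩ F _ id Z P :=
      (@IndepFun_iff_Indep Ω Ω (T → ℝ) mΩ F _ id Z P).2
        ((@MeasurableSpace.comap_id Ω F).symm ▸ hind.symm)
    have key := @setLIntegral_map_translate Ω Ω T mΩ F P _ id Z hid hZ hindf m hm A hA B hB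
    rw [integral_indicator (hX hB), setIntegral_const, smul_eq_mul, mul_one,
      measureReal_restrict_apply (hX hB)]
    rw [measureReal_def, Set.inter_comm]
    refine Eq.trans ?_ (congrArg ENNReal.toReal key)
    rw [← integral_toReal ((hκm.mono hF le_rfl).aemeasurable.restrict.congr ?_) ?_]
    · simp only [hκ, measureReal_def, Set.preimage_id, id]
    · exact Eventually.of_forall fun ω => by simp only [hκ, id]
    · refine Eventually.of_forall fun ω => ?_
      have := measure_lt_top (κ ω) B
      rwa [hκ] at this

end RegularCondLaw

end CcmfBm
-- The prediction theorem
theorem mainTheorem7 {Ω : Type*} [mΩ : MeasurableSpace Ω] (P : Measure Ω) [IsProbabilityMeasure P]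
    (H a b : ℝ) (hH : 1 / 2 < H) (hH1 : H < 1) (hab : a * b ≠ 0)
    (X : ℝ≥0 → Ω → ℝ) (hXm : ∀ t, Measurable (X t)) (hX : CcmfBm.IsCcmfBm H a b X P) (u : ℝ≥0) :
    -- `L^*` exists as a unique operator on `L²([0,u])`, and it is invertible
    ∃ Lstar : CcmfBm.L2 u ≃L[ℝ] CcmfBm.L2 u,
      (∀ A : CcmfBm.L2 u →L[ℝ] CcmfBm.L2 u,
        CcmfBm.IsAdjointAssociated (CcmfBm.L H a b) u A ↔ A = Lstar) ∧
    -- `Ψ(t,·|u) = (L^*)⁻¹ [L(t,·) - L(u,·)]`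
    ∃ Ψ : {t : ℝ≥0 // u ≤ t} → CcmfBm.L2 u,
      (∀ t, Lstar (Ψ t) =ᵐ[CcmfBm.lebesgueOn u]
        fun s => CcmfBm.L H a b (t : ℝ≥0) s - CcmfBm.L H a b u s) ∧
    -- the conditional mean
      (∀ t, (∃ Y, CcmfBm.IsWienerIntegral X P u (Ψ t) Y) ∧
        ∀ Y, CcmfBm.IsWienerIntegral X P u (Ψ t) Y →
          P[X t | CcmfBm.sigmaUpTo X u] =ᵐ[P] fun ω => X u ω + Y ω) ∧
    -- the conditional covariance
      (∀ t s : {t : ℝ≥0 // u ≤ t},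
        P[fun ω => (X t ω - (P[X t | CcmfBm.sigmaUpTo X u]) ω) *
            (X s ω - (P[X s | CcmfBm.sigmaUpTo X u]) ω) | CcmfBm.sigmaUpTo X u]
          =ᵐ[P] fun _ => CcmfBm.condR H a b u (t : ℝ≥0) (s : ℝ≥0)) ∧
    -- the conditional law of the future process is Gaussian, with this mean and covariance
      ∃ κ : @Kernel Ω ({t : ℝ≥0 // u ≤ t} → ℝ) (CcmfBm.sigmaUpTo X u) _,
        CcmfBm.IsRegularCondLaw (CcmfBm.sigmaUpTo X u)
          (fun ω (t : {t : ℝ≥0 // u ≤ t}) => X t ω) κ P ∧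
        (∀ ω, IsGaussianProcess
          (fun (t : {t : ℝ≥0 // u ≤ t}) (x : {t : ℝ≥0 // u ≤ t} → ℝ) => x t) (κ ω)) ∧
        (∀ t, ∀ᵐ ω ∂P, ∫ x, x t ∂(κ ω) = (P[X t | CcmfBm.sigmaUpTo X u]) ω) ∧
        ∀ ω, ∀ t s : {t : ℝ≥0 // u ≤ t},
          cov[fun x => x t, fun x => x s; κ ω] =
            CcmfBm.condR H a b u (t : ℝ≥0) (s : ℝ≥0) := by
  have ha : a ≠ 0 := left_ne_zero_of_mul hab
  obtain ⟨Lstar, hLs⟩ := CcmfBm.exists_adjointAssociated_equiv (b := b) hH hH1 ha u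
  obtain ⟨I, hXI, hI0, hG⟩ := CcmfBm.exists_isometry_of_isCcmfBm hH hH1 hX
  obtain ⟨T, hT⟩ := CcmfBm.exists_extendZero u
  have hLm (t : ℝ≥0) : MemLp (CcmfBm.L H a b t) 2 CcmfBm.halfLine :=
    CcmfBm.memLp_L hH hH1 t.coe_nonneg
  have hLu (t : ℝ≥0) : MemLp (CcmfBm.L H a b t) 2 (CcmfBm.lebesgueOn u) :=
    (hLm t).mono_measure (Measure.restrict_mono Set.Icc_subset_Ici_self le_rfl)
  have hVm (t : ℝ≥0) : MemLp ((Set.Ici (u : ℝ)).indicator (CcmfBm.L H a b t)) 2 CcmfBm.halfLine :=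
    (hLm t).indicator measurableSet_Ici
  have hF : (CcmfBm.sigmaUpTo X u) ≤ mΩ := CcmfBm.sigmaUpTo_le hXm u
  -- `J` is the Wiener integral against X: L^* maps 1_t to L(t,·), which `I` maps to X_t.
  set J : CcmfBm.L2 u →L[ℝ] Lp ℝ 2 P :=
    I.toContinuousLinearMap ∘L (T ∘L (Lstar : CcmfBm.L2 u →L[ℝ] CcmfBm.L2 u))
  have hJapp (f : CcmfBm.L2 u) : J f = I (T (Lstar f)) := rfl
  have hJ (t : ℝ≥0) (ht : t ≤ u) : J ((CcmfBm.memLp_ind (t : ℝ)).toLp) =ᵐ[P] X t := by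
    have h1 := (hLs Lstar).2 rfl t t.coe_nonneg (NNReal.coe_le_coe.2 ht) _
      (CcmfBm.memLp_ind (S := Set.Icc (0 : ℝ) u) (t : ℝ)).coeFn_toLp
    have h2 := CcmfBm.extendZero_eq_toLp hT (hLm t)
      (fun s hs => CcmfBm.L_of_le ((NNReal.coe_le_coe.2 ht).trans hs)) h1
    rw [hJapp]
    exact (show T (Lstar _) = _ from h2) ▸ (hXI t).symm
  set Ψ : {t : ℝ≥0 // u ≤ t} → CcmfBm.L2 u :=
    fun t => Lstar.symm ((hLu t).sub (hLu u)).toLp with hΨ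
  have hΨL (t : {t : ℝ≥0 // u ≤ t}) : Lstar (Ψ t) =ᵐ[CcmfBm.lebesgueOn u]
      fun s => CcmfBm.L H a b (t : ℝ≥0) s - CcmfBm.L H a b u s := by
    rw [hΨ, ContinuousLinearEquiv.apply_symm_apply]
    exact ((hLu t).sub (hLu u)).coeFn_toLp
  -- Below u the last term vanishes and the first two add up to L(t,·); above u only the last
  -- survives, since L(u,·) is zero there.
  have hdec (t : {t : ℝ≥0 // u ≤ t}) :
      (hLm t).toLp = (hLm u).toLp + T (Lstar (Ψ t)) + (hVm t).toLp := by
    have hg : ∀ᵐ x ∂CcmfBm.halfLine, x ∈ Set.Icc (0 : ℝ) u →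
        Lstar (Ψ t) x = CcmfBm.L H a b (t : ℝ≥0) x - CcmfBm.L H a b u x := by
      rw [← ae_restrict_iff' measurableSet_Icc, Measure.restrict_restrict measurableSet_Icc,
        Set.inter_eq_left.2 Set.Icc_subset_Ici_self]
      exact hΨL t
    refine Lp.ext ?_
    filter_upwards [hg, hT (Lstar (Ψ t)), (hLm t).coeFn_toLp, (hLm u).coeFn_toLp,
      (hVm t).coeFn_toLp, Lp.coeFn_add ((hLm u).toLp + T (Lstar (Ψ t))) (hVm t).toLp,
      Lp.coeFn_add (hLm u).toLp (T (Lstar (Ψ t))), CcmfBm.ae_pos_halfLine,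
      Measure.ae_ne (volume.restrict _) (u : ℝ)] with x h1 h2 h3 h4 h5 h6 h7 h8 h9
    rw [h6, Pi.add_apply, h7, Pi.add_apply, h2, h3, h4, h5]
    rcases lt_or_gt_of_ne h9 with h | h
    · have hx : x ∈ Set.Icc (0 : ℝ) u := ⟨h8.le, h.le⟩
      rw [Set.indicator_of_mem hx, h1 hx, Set.indicator_of_notMem (s := Set.Ici (u : ℝ)) (fun h' => not_le.2 h h')]
      ring
    · rw [Set.indicator_of_notMem (fun h' => not_le.2 h h'.2),
        Set.indicator_of_mem (s := Set.Ici (u : ℝ)) h.le, CcmfBm.L_of_le h.le]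
      ring
  have hXdec (t : {t : ℝ≥0 // u ≤ t}) :
      X t =ᵐ[P] (fun ω => X u ω + J (Ψ t) ω) + ⇑(I (hVm t).toLp) := by
    have h0 := hXI t
    rw [hdec t, map_add, map_add] at h0
    filter_upwards [h0, hXI u, Lp.coeFn_add (I (hLm u).toLp + I (T (Lstar (Ψ t)))) (I (hVm t).toLp),
      Lp.coeFn_add (I (hLm u).toLp) (I (T (Lstar (Ψ t))))] with ω h1 h2 h3 h4
    rw [h1, h3, Pi.add_apply, h4, Pi.add_apply, Pi.add_apply, h2, hJapp]
  -- The supports are disjoint: L(s,·) vanishes on [u,∞) for s ≤ u.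
  have horth (t : {t : ℝ≥0 // u ≤ t}) (s : ℝ≥0) (hs : s ≤ u) :
      inner ℝ (hVm t).toLp (hLm s).toLp = 0 := by
    rw [CcmfBm.inner_toLp]
    refine integral_eq_zero_of_ae (Eventually.of_forall fun v => ?_)
    by_cases hv : v ∈ Set.Ici (u : ℝ)
    · simp only [Pi.zero_apply]
      rw [CcmfBm.L_of_le ((NNReal.coe_le_coe.2 hs).trans hv), mul_zero]
    · simp [hv]
  have hgram (t s : {t : ℝ≥0 // u ≤ t}) :
      inner ℝ (hVm t).toLp (hVm s).toLp = CcmfBm.condR H a b u (t : ℝ≥0) (s : ℝ≥0) := by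
    rw [CcmfBm.inner_toLp, CcmfBm.integral_indicator_L_mul_L hH hH1 (NNReal.coe_nonneg _)
      (NNReal.coe_nonneg _)]
  have hcond (t : {t : ℝ≥0 // u ≤ t}) : P[X t | CcmfBm.sigmaUpTo X u] =ᵐ[P] fun ω => X u ω + J (Ψ t) ω := by
    have hind := CcmfBm.indep_of_inner_eq_zero hI0 hG hXI (u := u)
      (Z := fun _ : Unit => ⇑(I (hVm t).toLp)) (h := fun _ => (hVm t).toLp) (fun _ => ae_eq_rfl)
      (fun _ s hs => horth t s hs)
    have hmI : Measurable (I (hVm t).toLp) := (Lp.stronglyMeasurable _).measurable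
    have hVint : Integrable (I (hVm t).toLp) P := (Lp.memLp _).integrable (by norm_num)
    have hXint : Integrable (X u) P :=
      ((Lp.memLp (I (hLm u).toLp)).ae_eq (hXI u).symm).integrable (by norm_num)
    have hMint : Integrable (fun ω => X u ω + J (Ψ t) ω) P :=
      hXint.add ((Lp.memLp (J (Ψ t))).integrable (by norm_num))
    have hMm : AEStronglyMeasurable[CcmfBm.sigmaUpTo X u] (fun ω => X u ω + J (Ψ t) ω) P :=
      AEStronglyMeasurable.add
        (CcmfBm.measurable_sigmaUpTo X le_rfl).stronglyMeasurable.aestronglyMeasurable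
        (CcmfBm.aestronglyMeasurable_map hJ hXm (Ψ t))
    have h1 := condExp_congr_ae (m := (CcmfBm.sigmaUpTo X u)) (hXdec t)
    have h2 := condExp_add hMint hVint (CcmfBm.sigmaUpTo X u)
    have h3 := condExp_of_aestronglyMeasurable' hF hMm hMint
    have h4 : P[I (hVm t).toLp | CcmfBm.sigmaUpTo X u] =ᵐ[P] fun _ => 0 := by
      have hev : Measurable fun z : Unit → ℝ => z () := measurable_pi_apply ()
      have := condExp_indep_eq (m₁ := MeasurableSpace.comap
        (fun ω (_ : Unit) => I (hVm t).toLp ω) inferInstance) (f := I (hVm t).toLp)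
        (measurable_pi_lambda _ fun _ => hmI).comap_le hF
        (hev.comp (comap_measurable fun ω (_ : Unit) => I (hVm t).toLp ω)).stronglyMeasurable hind
      simpa only [hI0] using this
    filter_upwards [h1, h2, h3, h4] with ω e1 e2 e3 e4
    rw [e1, e2, Pi.add_apply, e3, e4, add_zero]
  -- With a fixed version of the conditional mean, X = m + Z holds for every ω and every t. Since
  -- uncountably many times are involved, this pointwise identity is what gives the conditional law
  -- of the whole path.
  set m : Ω → {t : ℝ≥0 // u ≤ t} → ℝ := fun ω t => (P[X t | CcmfBm.sigmaUpTo X u]) ω with hm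
  set Z : {t : ℝ≥0 // u ≤ t} → Ω → ℝ := fun t ω => X t ω - m ω t with hZdef
  have hmF (t : {t : ℝ≥0 // u ≤ t}) : Measurable[CcmfBm.sigmaUpTo X u] fun ω => m ω t :=
    stronglyMeasurable_condExp.measurable
  have hZm (t : {t : ℝ≥0 // u ≤ t}) : Measurable (Z t) :=
    (hXm t).sub ((hmF t).mono hF le_rfl)
  have hZV (t : {t : ℝ≥0 // u ≤ t}) : Z t =ᵐ[P] I (hVm t).toLp := by
    filter_upwards [hXdec t, hcond t] with ω h1 h2
    simp only [hZdef, hm]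
    rw [h1, h2, Pi.add_apply, add_sub_cancel_left]
  have hZind : Indep (MeasurableSpace.comap (fun ω t => Z t ω) inferInstance) (CcmfBm.sigmaUpTo X u) P :=
    CcmfBm.indep_of_inner_eq_zero hI0 hG hXI hZV horth
  have hZvm : Measurable fun ω t => Z t ω := measurable_pi_lambda _ hZm
  have hZ2 (t : {t : ℝ≥0 // u ≤ t}) : MemLp (Z t) 2 P := (Lp.memLp _).ae_eq (hZV t).symm
  have hZ1 (t : {t : ℝ≥0 // u ≤ t}) : Integrable (Z t) P := (hZ2 t).integrable (by norm_num)
  have hZG : IsGaussianProcess Z P :=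
    (hG.comp_right fun t : {t : ℝ≥0 // u ≤ t} => (hVm t).toLp).congr fun t => (hZV t).symm
  refine ⟨Lstar, hLs, Ψ, hΨL, fun t => ⟨⟨J (Ψ t), CcmfBm.isWienerIntegral_map hJ _⟩,
    fun Y hY => ?_⟩, fun t s => ?_, ?_⟩
  · filter_upwards [hcond t, hY.ae_eq hJ (g := Ψ t) ae_eq_rfl] with ω h1 h2
    rw [h1, h2]
  · have hev : Measurable fun z : {t : ℝ≥0 // u ≤ t} → ℝ => z t * z s :=
      (measurable_pi_apply t).mul (measurable_pi_apply s)
    have hprod := condExp_indep_eq (μ := P) (f := fun ω => Z t ω * Z s ω)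
      (m₁ := MeasurableSpace.comap (fun ω t => Z t ω) inferInstance) hZvm.comap_le hF
      (hev.comp (comap_measurable fun ω t => Z t ω)).stronglyMeasurable hZind
    rw [CcmfBm.integral_mul_eq_inner (hZV t) (hZV s), hgram] at hprod
    exact hprod
  · have : IsProbabilityMeasure (P.map fun ω t => Z t ω) :=
      Measure.isProbabilityMeasure_map hZvm.aemeasurable
    obtain ⟨κ, hκ⟩ := @CcmfBm.exists_kernel_translate Ω _ (CcmfBm.sigmaUpTo X u) (P.map fun ω t => Z t ω) _ m hmF
    have hκ' (ω : Ω) : κ ω = P.map fun ω' t => m ω t + Z t ω' := by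
      rw [hκ, Measure.map_map (measurable_pi_lambda _ fun t =>
        (measurable_pi_apply t).const_add (m ω t)) hZvm]
      rfl
    have hYm (ω : Ω) (t : {t : ℝ≥0 // u ≤ t}) : Measurable fun ω' => m ω t + Z t ω' :=
      (hZm t).const_add _
    have hYvm (ω : Ω) : Measurable fun ω' t => m ω t + Z t ω' :=
      measurable_pi_lambda _ (hYm ω)
    refine ⟨κ, ?_, fun ω => ?_, fun t => Eventually.of_forall fun ω => ?_, fun ω t s => ?_⟩
    · have := CcmfBm.isRegularCondLaw_translate hF hZvm hZind hmF hκ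
      simpa only [hZdef, add_sub_cancel] using this
    · rw [hκ']
      exact CcmfBm.isGaussianProcess_eval_map
        (CcmfBm.isGaussianProcess_const_add hZG (m ω)) (hYm ω)
    · rw [hκ', integral_map (hYvm ω).aemeasurable
        (measurable_pi_apply t).aestronglyMeasurable, integral_add (integrable_const _) (hZ1 t),
        integral_congr_ae (hZV t), hI0]
      simp [hm]
    · rw [hκ', covariance_map (measurable_pi_apply t).aestronglyMeasurable
        (measurable_pi_apply s).aestronglyMeasurable (hYvm ω).aemeasurable]
      change cov[fun ω' => m ω t + Z t ω', fun ω' => m ω s + Z s ω'; P] = _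
      rw [covariance_const_add_left (hZ1 t), covariance_const_add_right (hZ1 s),
        CcmfBm.covariance_eq_inner hI0 (hZV t) (hZV s), hgram]
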